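/- For an integer $n\ge 1$ and $\lambda\in\mathbb{R}$ put $p_{n,\lambda}=n^{-1}+\lambda n^{-4/3}$ and $F_\lambda(x)=\frac{x^3}{6}-\frac{\lambda x^2}{2}+\frac{\lambda^2x}{2}$. Whenever $p_{n,\lambda}\in[0,1]$, let $\mathbb{P}_{n,\lambda}$ be the law of the Erdős–Rényi random graph on $n$ labelled vertices in which each pair of distinct vertices is joined by an edge independently with probability $p_{n,\lambda}$. For a vertex $v$ let $|\mathcal{C}(v)|$ be the number of vertices in the connected component containing $v$. For every real $M>0$ there exist constants $0<c_1\le c_2<\infty$, depending only on $M$, such that for all integers $n\ge1$, all real $\lambda$ with $|\lambda|\le n^{1/12}$ and $p_{n,\lambda}\in[0,1]$ (the latter is automatic when $n\ge2$), every vertex $v$, and every integer $k$ with $1\le k\le n$ and $k\le Mn^{2/3}$, $$c_1k^{-3/2}e^{-F_\lambda(k/n^{2/3})}\le\mathbb{P}_{n,\lambda}\big(|\mathcal{C}(v)|=k\big)\le c_2k^{-3/2}e^{-F_\lambda(k/n^{2/3})}.$$ -/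

import Mathlib

open MeasureTheory

noncomputable section

/-- The edge probability `p = n⁻¹ + λ n^{-4/3}` in the critical window. -/
def edgeProb (n : ℕ) (lam : ℝ) : ℝ := (n : ℝ)⁻¹ + lam * (n : ℝ) ^ (-(4 / 3) : ℝ)

/-- `F_λ(x) = x³/6 - λx²/2 + λ²x/2`. -/
def critF (lam x : ℝ) : ℝ := x ^ 3 / 6 - lam * x ^ 2 / 2 + lam ^ 2 * x / 2

/-- `|C(v)|`: the number of vertices in the connected component of `G` containing `v`. -/
def componentSize {n : ℕ} (G : SimpleGraph (Fin n)) (v : Fin n) : ℕ :=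
  (G.connectedComponentMk v).supp.ncard

/-- The law of the Erdős–Rényi random graph on `n` labelled vertices with edge probability
`edgeProb n lam`, whenever that number is a probability. -/
def erdosRenyiLaw (n : ℕ) (lam : ℝ) (hp : edgeProb n lam ∈ Set.Icc (0 : ℝ) 1) :
    Measure (SimpleGraph (Fin n)) :=
  SimpleGraph.binomialRandom (Fin n) ⟨edgeProb n lam, hp⟩

end

/-!
The component of `v` is a given set of `k` vertices exactly when the graph is connected on this set
and has no edge leaving it (`sum_graphWeight_supp_eq`). With `κ_k` (`connProb`) the probability that
the random graph on `k` vertices is connected, this gives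
`P(|C(v)| = k) = (n-1).choose (k-1) * κ_k * (1-p)^(k(n-k))` (`erdosRenyiLaw_componentSize`).

These probabilities add up to `1` for every `n`, which determines `κ`. The solution of the recursion
that a vertex by vertex exploration obeys (`exploreProb`) satisfies the same identities, hence
`κ_k = exploreProb p k 1` (`connProb_eq_exploreProb`). Extracting powers of `p` and `1 - p`, the
recursion becomes the one that counts rooted forests, with an additional weight `(1-p)⁻¹` per active
vertex and step. Without the weight it is solved by `a N^(N-a-1)`, and since the weight is at least
`1` this gives `κ_k ≥ k^(k-2) p^(k-1) (1-p)^(k.choose 2)` (`le_connProb`).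

The weight raises `κ_k` by at most a bounded factor while `p k^(3/2)` is bounded (`connProb_le`):
the factor is an exponential moment of `k^(-3/2)` times the area under an excursion of length `k`. The
bound comes from an explicit supersolution of the weighted recursion,
`N^(N-a-1) e^(βN/k) sinh(θa)` with `θ` of order `k^(-1/2)`. One step of the recursion averages over
a binomial variable, whose moment generating function is explicit (`sub_mgf_le`). The step contracts
`a` to `(1 - 1/N) a` on average; for `θa` large the resulting loss in `sinh` beats the weight, and
for `θa` bounded the weight is `1 + O(1/k)` and is absorbed into `e^(β/k)` (`sinh_contract_le`,
`sum_choose_mul_sinh_le`).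

It remains to see that the tree term `treeTerm` is of order `k^(-3/2) e^(-F)`
(`treeTerm_bounds`). With `p = (1+x)/n`, its logarithm is expanded to the order where the errors
`k^4/n^3`, `k |x|^3` and `k/n` are bounded; Stirling's formula gives `k^(-3/2)`, and the remaining
terms add up to `-F`.
-/

/-! ### Weights of graphs -/

/-- The probability that the binomial random graph on `V` with edge probability `p` equals `G`. -/
noncomputable def graphWeight {V : Type*} [Fintype V] (p : ℝ) (G : SimpleGraph V) : ℝ :=
  p ^ G.edgeSet.ncard * (1 - p) ^ ((Fintype.card V).choose 2 - G.edgeSet.ncard)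

open scoped Classical in
lemma binomialRandom_real_eq_sum {V : Type*} [Fintype V] (p : unitInterval)
    (A : Set (SimpleGraph V)) :
    (SimpleGraph.binomialRandom V p).real A = ∑ G with G ∈ A, graphWeight (p : ℝ) G := by
  have hA : A = ((Finset.univ.filter (· ∈ A) : Finset (SimpleGraph V)) : Set (SimpleGraph V)) := by
    ext; simp
  have hs : MeasurableSingletonClass (SimpleGraph V) := ⟨fun G => by
    rw [← SimpleGraph.measurableEmbedding_edgeSet.measurableSet_image]
    exact (Set.toFinite _).measurableSet⟩
  conv_lhs => rw [hA]
  rw [← MeasureTheory.sum_measureReal_singleton]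
  refine Finset.sum_congr rfl fun G _ => ?_
  simp [MeasureTheory.measureReal_def, graphWeight]

lemma sum_graphWeight {V : Type*} [Fintype V] [DecidableEq V] [Fintype (SimpleGraph V)] (p : ℝ)
    (hp : p ∈ Set.Icc (0 : ℝ) 1) :
    ∑ G : SimpleGraph V, graphWeight p G = 1 := by
  classical
  have h := binomialRandom_real_eq_sum (V := V) ⟨p, hp⟩ Set.univ
  rw [probReal_univ] at h
  rw [h]
  simp only [Set.mem_univ, Finset.filter_true]
  congr!

open scoped Classical in
/-- The probability that the binomial random graph on `k` vertices is connected. -/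
noncomputable def connProb (p : ℝ) (k : ℕ) : ℝ :=
  ∑ G : SimpleGraph (Fin k) with G.Connected, graphWeight p G

open scoped Classical in
lemma sum_connected_graphWeight {V : Type*} [Fintype V] (p : ℝ) :
    ∑ G : SimpleGraph V with G.Connected, graphWeight p G = connProb p (Fintype.card V) := by
  rw [connProb]
  let e : V ≃ Fin (Fintype.card V) := Fintype.equivFin V
  refine Finset.sum_equiv e.simpleGraph (fun G => ?_) (fun G _ => ?_)
  · simp only [Finset.mem_filter, Finset.mem_univ, true_and]
    have i : G ≃g e.simpleGraph G := (SimpleGraph.Iso.comap e.symm G).symm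
    exact i.connected_iff
  · have i : G ≃g e.simpleGraph G := (SimpleGraph.Iso.comap e.symm G).symm
    have hc : G.edgeSet.ncard = (e.simpleGraph G).edgeSet.ncard := by
      rw [← Nat.card_coe_set_eq, ← Nat.card_coe_set_eq]
      exact Nat.card_congr i.mapEdgeSet
    simp [graphWeight, hc]

/-! ### Splitting a graph along a component -/

/-- The graph on `V` which is `H` on `S`, `K` off `S`, and has no edge between `S` and its
complement. -/
def glueGraph {V : Type*} (S : Finset V) (H : SimpleGraph S) (K : SimpleGraph {x // x ∉ S}) :
    SimpleGraph V :=
  H.map (Function.Embedding.subtype (· ∈ S)) ⊔ K.map (Function.Embedding.subtype (· ∉ S))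

section Glue

variable {V : Type*} {S : Finset V} {H : SimpleGraph S} {K : SimpleGraph {x // x ∉ S}}

lemma glueGraph_adj {x y : V} : (glueGraph S H K).Adj x y ↔
    (∃ (hx : x ∈ S) (hy : y ∈ S), H.Adj ⟨x, hx⟩ ⟨y, hy⟩) ∨
      ∃ (hx : x ∉ S) (hy : y ∉ S), K.Adj ⟨x, hx⟩ ⟨y, hy⟩ := by
  simp only [glueGraph, SimpleGraph.sup_adj, SimpleGraph.map_adj]
  refine or_congr ⟨?_, ?_⟩ ⟨?_, ?_⟩
  · rintro ⟨a, b, h, rfl, rfl⟩; exact ⟨a.2, b.2, h⟩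
  · rintro ⟨hx, hy, h⟩; exact ⟨_, _, h, rfl, rfl⟩
  · rintro ⟨a, b, h, rfl, rfl⟩; exact ⟨a.2, b.2, h⟩
  · rintro ⟨hx, hy, h⟩; exact ⟨_, _, h, rfl, rfl⟩

lemma ncard_edgeSet_glueGraph [Fintype V] :
    (glueGraph S H K).edgeSet.ncard = H.edgeSet.ncard + K.edgeSet.ncard := by
  classical
  rw [glueGraph, SimpleGraph.edgeSet_sup, Set.ncard_union_eq]
  · rw [SimpleGraph.edgeSet_map, SimpleGraph.edgeSet_map,
      Set.ncard_image_of_injective _ (Function.Embedding.injective _),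
      Set.ncard_image_of_injective _ (Function.Embedding.injective _)]
  · rw [SimpleGraph.disjoint_edgeSet, disjoint_iff]
    ext x y
    simp only [SimpleGraph.inf_adj, SimpleGraph.map_adj, SimpleGraph.bot_adj, iff_false]
    rintro ⟨⟨a, -, -, rfl, -⟩, ⟨b, -, -, h, -⟩⟩
    exact b.2 (by rw [show (b : V) = a from h]; exact a.2)

lemma ncard_edgeSet_le {W : Type*} [Fintype W] (G : SimpleGraph W) :
    G.edgeSet.ncard ≤ (Fintype.card W).choose 2 := by
  classical
  rw [← SimpleGraph.coe_edgeFinset, Set.ncard_coe_finset]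
  exact SimpleGraph.card_edgeFinset_le_card_choose_two

lemma choose_two_add (a b : ℕ) :
    (a + b).choose 2 = a.choose 2 + b.choose 2 + a * b := by
  have : (((a + b).choose 2 : ℕ) : ℚ) = ((a.choose 2 + b.choose 2 + a * b : ℕ) : ℚ) := by
    push_cast
    rw [Nat.cast_choose_two, Nat.cast_choose_two, Nat.cast_choose_two]
    push_cast
    ring
  exact_mod_cast this

lemma graphWeight_glueGraph [Fintype V] [DecidableEq V] (p : ℝ) :
    graphWeight p (glueGraph S H K) = graphWeight p H * graphWeight p K *
      (1 - p) ^ (S.card * (Fintype.card V - S.card)) := by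
  have h1 := ncard_edgeSet_le H
  have h2 := ncard_edgeSet_le K
  have hS : Fintype.card S = S.card := Fintype.card_coe S
  have hT : Fintype.card {x // x ∉ S} = Fintype.card V - S.card := by
    rw [Fintype.card_subtype_compl, hS]
  have hle : S.card ≤ Fintype.card V := S.card_le_univ
  have h3 := choose_two_add S.card (Fintype.card V - S.card)
  rw [Nat.add_sub_cancel' hle] at h3
  simp only [graphWeight, ncard_edgeSet_glueGraph]
  rw [hS] at h1 ⊢
  rw [hT] at h2 ⊢
  rw [h3, show ∀ a b c d e : ℕ, d ≤ a → e ≤ b → a + b + c - (d + e) = (a - d) + (b - e) + c by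
    intros; omega]
  · ring
  · exact h1
  · exact h2

lemma supp_glueGraph (hH : H.Connected) (v : V) (hv : v ∈ S) :
    ((glueGraph S H K).connectedComponentMk v).supp = S := by
  ext x
  rw [SimpleGraph.ConnectedComponent.mem_supp_iff, SimpleGraph.ConnectedComponent.eq, Finset.mem_coe]
  constructor
  · rintro ⟨w⟩
    induction w with
    | nil => exact hv
    | cons h _ ih =>
      rcases glueGraph_adj.1 h with ⟨hx, hy, _⟩ | ⟨hx, hy, _⟩
      · exact hx
      · exact absurd (ih hv) hy
  · intro hx
    let f : H →g glueGraph S H K := ⟨Subtype.val, fun {a b} h =>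
      glueGraph_adj.2 (Or.inl ⟨a.2, b.2, h⟩)⟩
    exact (hH.preconnected ⟨x, hx⟩ ⟨v, hv⟩).map f

lemma glueGraph_induce (G : SimpleGraph V) (v : V)
    (h : (G.connectedComponentMk v).supp = S) :
    glueGraph S (G.comap Subtype.val) (G.comap Subtype.val) = G := by
  ext x y
  rw [glueGraph_adj]
  simp only [SimpleGraph.comap_adj]
  have key : ∀ {a b}, G.Adj a b → (a ∈ S ↔ b ∈ S) := by
    intro a b hab
    have := (G.connectedComponentMk v).mem_supp_congr_adj hab
    rwa [h] at this
  constructor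
  · rintro (⟨_, _, h⟩ | ⟨_, _, h⟩) <;> exact h
  · intro hxy
    by_cases hx : x ∈ S
    · exact Or.inl ⟨hx, (key hxy).1 hx, hxy⟩
    · exact Or.inr ⟨hx, fun hy => hx ((key hxy).2 hy), hxy⟩

lemma connected_comap_of_supp (G : SimpleGraph V) (v : V)
    (h : (G.connectedComponentMk v).supp = S) :
    (G.comap (Subtype.val : S → V)).Connected := by
  have h1 := (G.connectedComponentMk v).connected_toSimpleGraph
  have : ∀ T : Set V, T = S → (G.induce T).Connected → (G.comap (Subtype.val : S → V)).Connected := by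
    rintro _ rfl h; exact h
  exact this _ h h1

lemma comap_glueGraph_left : (glueGraph S H K).comap (Subtype.val : S → V) = H := by
  ext x y
  simp [glueGraph_adj]

lemma comap_glueGraph_right :
    (glueGraph S H K).comap (Subtype.val : {x // x ∉ S} → V) = K := by
  ext ⟨x, hx⟩ ⟨y, hy⟩
  simp [glueGraph_adj, hx, hy]

end Glue

open scoped Classical in
/-- The component of `v` equals `S` when the graph is connected on `S` and no edge leaves `S`. -/
lemma sum_graphWeight_supp_eq {V : Type*} [Fintype V] (p : ℝ) (hp : p ∈ Set.Icc (0 : ℝ) 1)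
    (v : V) (S : Finset V) (hv : v ∈ S) :
    ∑ G : SimpleGraph V with (G.connectedComponentMk v).supp = (S : Set V),
      graphWeight p G =
      connProb p S.card * (1 - p) ^ (S.card * (Fintype.card V - S.card)) := by
  have h1 : connProb p S.card = ∑ G : SimpleGraph S with G.Connected, graphWeight p G := by
    rw [← Fintype.card_coe S, ← sum_connected_graphWeight]
    congr!
  have h2 : ∑ K : SimpleGraph {x // x ∉ S}, graphWeight p K = 1 := sum_graphWeight p hp
  have h3 : connProb p S.card = ∑ x ∈ (Finset.univ.filter fun H : SimpleGraph S => H.Connected) ×ˢ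
      (Finset.univ : Finset (SimpleGraph {x // x ∉ S})), graphWeight p x.1 * graphWeight p x.2 := by
    rw [Finset.sum_product]
    simp only
    rw [← Finset.sum_mul_sum, h2, mul_one, h1]
  rw [h3, Finset.sum_mul]
  refine Finset.sum_bij' (fun G _ => (G.comap Subtype.val, G.comap Subtype.val))
    (fun x _ => glueGraph S x.1 x.2) ?_ ?_ ?_ ?_ ?_
  · intro G hG
    simp only [Finset.mem_filter, Finset.mem_univ, true_and] at hG
    simp only [Finset.mem_product, Finset.mem_filter, Finset.mem_univ, true_and, and_true]
    exact connected_comap_of_supp G v hG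
  · rintro ⟨H, K⟩ hx
    simp only [Finset.mem_product, Finset.mem_filter, Finset.mem_univ, true_and, and_true] at hx ⊢
    exact supp_glueGraph hx v hv
  · intro G hG
    simp only [Finset.mem_filter, Finset.mem_univ, true_and] at hG
    exact glueGraph_induce G v hG
  · rintro ⟨H, K⟩ hx
    exact Prod.ext comap_glueGraph_left comap_glueGraph_right
  · intro G hG
    simp only [Finset.mem_filter, Finset.mem_univ, true_and] at hG
    rw [← graphWeight_glueGraph, glueGraph_induce G v hG]

open scoped Classical in
lemma sum_graphWeight_componentSize {n : ℕ} (p : ℝ) (hp : p ∈ Set.Icc (0 : ℝ) 1)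
    (v : Fin n) (k : ℕ) :
    ∑ G : SimpleGraph (Fin n) with componentSize G v = k, graphWeight p G =
      if k = 0 then 0 else
        ((n - 1).choose (k - 1) : ℝ) * connProb p k * (1 - p) ^ (k * (n - k)) := by
  split_ifs with hk
  · refine Finset.sum_eq_zero fun G hG => ?_
    simp only [Finset.mem_filter, Finset.mem_univ, true_and, componentSize, hk] at hG
    rw [Set.ncard_eq_zero] at hG
    exact absurd hG (G.connectedComponentMk v).nonempty_supp.ne_empty
  have hcard : ((Finset.univ.powersetCard k).filter (fun S : Finset (Fin n) => v ∈ S)).card =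
      (n - 1).choose (k - 1) := by
    have : (Finset.univ.powersetCard k).filter (fun S : Finset (Fin n) => v ∈ S) =
        ((Finset.univ.erase v).powersetCard (k - 1)).image (insert v) := by
      ext S
      simp only [Finset.mem_filter, Finset.mem_powersetCard, Finset.mem_image, Finset.subset_univ,
        true_and]
      constructor
      · rintro ⟨h1, h2⟩
        refine ⟨S.erase v, ⟨Finset.erase_subset_erase _ (Finset.subset_univ _), ?_⟩,
          Finset.insert_erase h2⟩
        rw [Finset.card_erase_of_mem h2, h1]
      · rintro ⟨T, ⟨h1, h2⟩, rfl⟩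
        have hvT : v ∉ T := fun h => Finset.notMem_erase v _ (h1 h)
        refine ⟨?_, Finset.mem_insert_self _ _⟩
        rw [Finset.card_insert_of_notMem hvT, h2]
        omega
    rw [this, Finset.card_image_of_injOn, Finset.card_powersetCard, Finset.card_erase_of_mem
      (Finset.mem_univ _), Finset.card_univ, Fintype.card_fin]
    intro A hA B hB hAB
    have hvA : v ∉ A := fun h => Finset.notMem_erase v _ ((Finset.mem_powersetCard.1 hA).1 h)
    have hvB : v ∉ B := fun h => Finset.notMem_erase v _ ((Finset.mem_powersetCard.1 hB).1 h)
    rw [← Finset.erase_insert hvA, ← Finset.erase_insert hvB]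
    exact congrArg (fun T => T.erase v) hAB
  have hmaps : ∀ G ∈ Finset.univ.filter (fun G : SimpleGraph (Fin n) => componentSize G v = k),
      (G.connectedComponentMk v).supp.toFinset ∈
        (Finset.univ.powersetCard k).filter (fun S : Finset (Fin n) => v ∈ S) := by
    intro G hG
    have hG' : (G.connectedComponentMk v).supp.ncard = k := (Finset.mem_filter.1 hG).2
    rw [Finset.mem_filter, Finset.mem_powersetCard, ← Set.ncard_eq_toFinset_card', hG']
    refine ⟨⟨Finset.subset_univ _, rfl⟩, ?_⟩
    rw [Set.mem_toFinset]
    rfl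
  rw [← Finset.sum_fiberwise_of_maps_to hmaps, Finset.sum_congr rfl
    (g := fun _ => connProb p k * (1 - p) ^ (k * (n - k))), Finset.sum_const, hcard, nsmul_eq_mul,
    mul_assoc]
  intro S hS
  simp only [Finset.mem_filter, Finset.mem_powersetCard, Finset.subset_univ, true_and] at hS
  have := sum_graphWeight_supp_eq p hp v S hS.2
  rw [hS.1, Fintype.card_fin] at this
  rw [← this]
  refine Finset.sum_congr ?_ fun _ _ => rfl
  ext G
  simp only [Finset.mem_filter, Finset.mem_univ, true_and]
  constructor
  · rintro ⟨_, h⟩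
    rw [← h, Set.coe_toFinset]
  · intro h
    refine ⟨?_, ?_⟩
    · rw [componentSize, h, Set.ncard_coe_finset, hS.1]
    · ext x
      rw [Set.mem_toFinset, h, Finset.mem_coe]

/-- The law of the component size, in terms of the connectedness probability. -/
lemma erdosRenyiLaw_componentSize {n : ℕ} (lam : ℝ) (hp : edgeProb n lam ∈ Set.Icc (0 : ℝ) 1)
    (v : Fin n) (k : ℕ) (hk : 1 ≤ k) :
    (erdosRenyiLaw n lam hp).real {G | componentSize G v = k} =
      ((n - 1).choose (k - 1) : ℝ) * connProb (edgeProb n lam) k *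
        (1 - edgeProb n lam) ^ (k * (n - k)) := by
  classical
  rw [erdosRenyiLaw, binomialRandom_real_eq_sum]
  have := sum_graphWeight_componentSize (edgeProb n lam) hp v k
  rw [if_neg (by omega)] at this
  rw [← this]
  congr!

/-- The component sizes exhaust the probability space; these identities determine `connProb`. -/
lemma sum_choose_mul_connProb (p : ℝ) (hp : p ∈ Set.Icc (0 : ℝ) 1) (u : ℕ) :
    ∑ s ∈ Finset.range (u + 1),
      (u.choose s : ℝ) * connProb p (s + 1) * (1 - p) ^ ((s + 1) * (u - s)) = 1 := by
  classical
  have hmaps : ∀ G ∈ (Finset.univ : Finset (SimpleGraph (Fin (u + 1)))),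
      componentSize G 0 ∈ Finset.range (u + 2) := by
    intro G _
    rw [Finset.mem_range, componentSize, Nat.lt_succ_iff]
    calc _ ≤ (Set.univ : Set (Fin (u + 1))).ncard := Set.ncard_le_ncard (Set.subset_univ _)
      _ = u + 1 := by simp
  have h1 : ∑ G : SimpleGraph (Fin (u + 1)), graphWeight p G = 1 := sum_graphWeight p hp
  rw [← Finset.sum_fiberwise_of_maps_to hmaps] at h1
  simp only [sum_graphWeight_componentSize p hp] at h1
  rw [Finset.sum_range_succ', if_pos rfl, add_zero] at h1
  refine Eq.trans (Finset.sum_congr rfl fun s _ => ?_) h1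
  rw [if_neg (by omega)]
  simp only [Nat.add_sub_cancel]
  rw [show u + 1 - (s + 1) = u - s by omega]

/-! ### The exploration recursion -/

/-- The probability that, starting from `a` active vertices among `N` and with edge probability
`p`, the exploration of the random graph discovers all `N` vertices: each step removes an active
vertex and activates its undiscovered neighbours, so that `N` counts the vertices not yet removed and
`N - a` the undiscovered ones. Only `a ≤ N` is meaningful, and the recursion stays in this range. -/
noncomputable def exploreProb (p : ℝ) : ℕ → ℕ → ℝ
  | 0, 0 => 1
  | 0, _ + 1 => 0
  | _ + 1, 0 => 0
  | N + 1, a + 1 => ∑ x ∈ Finset.range (N - a + 1),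
      ((N - a).choose x : ℝ) * p ^ x * (1 - p) ^ (N - a - x) * exploreProb p N (a + x)

lemma exploreProb_succ (p : ℝ) (N a : ℕ) :
    exploreProb p (N + 1) (a + 1) = ∑ x ∈ Finset.range (N - a + 1),
      ((N - a).choose x : ℝ) * p ^ x * (1 - p) ^ (N - a - x) * exploreProb p N (a + x) := by
  rw [exploreProb]

/-- The explored part has some size: of `u` undiscovered vertices, `s` are discovered and the other
`u - s` have no edge to the `a + s` explored ones. -/
lemma sum_choose_mul_exploreProb (p : ℝ) : ∀ N a u : ℕ, a + u = N →
    ∑ s ∈ Finset.range (u + 1),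
      (u.choose s : ℝ) * exploreProb p (a + s) a * (1 - p) ^ ((a + s) * (u - s)) = 1 := by
  intro N
  induction N with
  | zero =>
    intro a u h
    obtain ⟨rfl, rfl⟩ : a = 0 ∧ u = 0 := by omega
    simp [exploreProb]
  | succ N ih =>
    intro a u h
    cases a with
    | zero =>
      rw [Finset.sum_range_succ', Finset.sum_eq_zero]
      · simp [exploreProb]
      · intro s _
        rw [show 0 + (s + 1) = s + 1 by omega, exploreProb]
        ring
    | succ a =>
      have hstep : ∀ s ∈ Finset.range (u + 1),
          (u.choose s : ℝ) * exploreProb p (a + 1 + s) (a + 1) * (1 - p) ^ ((a + 1 + s) * (u - s)) =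
          ∑ x ∈ Finset.range (s + 1), (u.choose x : ℝ) * p ^ x * (1 - p) ^ (u - x) *
            (((u - x).choose (s - x) : ℝ) * exploreProb p (a + x + (s - x)) (a + x) *
              (1 - p) ^ ((a + x + (s - x)) * (u - x - (s - x)))) := by
        intro s hs
        have hsu : s ≤ u := Nat.lt_succ_iff.1 (Finset.mem_range.1 hs)
        rw [show a + 1 + s = (a + s) + 1 by omega, exploreProb_succ,
          show a + s - a = s by omega, Finset.mul_sum, Finset.sum_mul]
        refine Finset.sum_congr rfl fun x hx => ?_
        have hxs : x ≤ s := Nat.lt_succ_iff.1 (Finset.mem_range.1 hx)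
        have hc : (u.choose s : ℝ) * (s.choose x : ℝ) =
            (u.choose x : ℝ) * ((u - x).choose (s - x) : ℝ) := by
          exact_mod_cast Nat.choose_mul hxs
        have hpow : (1 - p) ^ (s - x) * (1 - p) ^ ((a + s + 1) * (u - s)) =
            (1 - p) ^ (u - x) * (1 - p) ^ ((a + x + (s - x)) * (u - x - (s - x))) := by
          rw [← pow_add, ← pow_add]
          congr 1
          obtain ⟨y, rfl⟩ := Nat.exists_eq_add_of_le hxs
          obtain ⟨z, rfl⟩ := Nat.exists_eq_add_of_le hsu
          rw [show x + y - x = y by omega, show x + y + z - (x + y) = z by omega,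
            show x + y + z - x = y + z by omega, show y + z - y = z by omega]
          ring
        rw [show a + x + (s - x) = a + s by omega] at hpow ⊢
        calc _ = ((u.choose s : ℝ) * (s.choose x : ℝ)) * p ^ x * exploreProb p (a + s) (a + x) *
              ((1 - p) ^ (s - x) * (1 - p) ^ ((a + s + 1) * (u - s))) := by ring
          _ = _ := by rw [hc, hpow]; ring
      rw [Finset.sum_congr rfl hstep, Finset.range_eq_Ico, Finset.sum_sigma',
        Finset.sum_bij' (s := (Finset.Ico 0 (u + 1)).sigma fun s => Finset.range (s + 1))
          (t := (Finset.range (u + 1)).sigma fun x => Finset.range (u - x + 1))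
          (g := fun z => (u.choose z.1 : ℝ) * p ^ z.1 * (1 - p) ^ (u - z.1) *
            (((u - z.1).choose z.2 : ℝ) * exploreProb p (a + z.1 + z.2) (a + z.1) *
              (1 - p) ^ ((a + z.1 + z.2) * (u - z.1 - z.2))))
          (fun z _ => ⟨z.2, z.1 - z.2⟩) (fun z _ => ⟨z.1 + z.2, z.1⟩), Finset.sum_sigma]
      · have hin : ∀ x ∈ Finset.range (u + 1),
            ∑ y ∈ Finset.range (u - x + 1), (u.choose x : ℝ) * p ^ x * (1 - p) ^ (u - x) *
              (((u - x).choose y : ℝ) * exploreProb p (a + x + y) (a + x) *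
                (1 - p) ^ ((a + x + y) * (u - x - y))) =
            p ^ x * (1 - p) ^ (u - x) * (u.choose x : ℝ) := by
          intro x hx
          have hxu : x ≤ u := Nat.lt_succ_iff.1 (Finset.mem_range.1 hx)
          rw [← Finset.mul_sum, ih (a + x) (u - x) (by omega)]
          ring
        rw [Finset.sum_congr rfl hin, ← add_pow]
        simp
      · rintro ⟨s, x⟩ h
        simp only [Finset.mem_sigma, Finset.mem_Ico, Finset.mem_range] at h ⊢
        omega
      · rintro ⟨x, y⟩ h
        simp only [Finset.mem_sigma, Finset.mem_Ico, Finset.mem_range] at h ⊢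
        omega
      · rintro ⟨s, x⟩ h
        simp only [Finset.mem_sigma, Finset.mem_Ico, Finset.mem_range] at h
        simp only [show x + (s - x) = s by omega]
      · rintro ⟨x, y⟩ h
        simp
      · rintro ⟨s, x⟩ h
        rfl

/-- Both sides solve the triangular system saying that the component sizes have total mass `1`, so
no exploration process has to be constructed on the random graph itself. -/
lemma connProb_eq_exploreProb (p : ℝ) (hp : p ∈ Set.Icc (0 : ℝ) 1) (u : ℕ) :
    connProb p (u + 1) = exploreProb p (u + 1) 1 := by
  induction u using Nat.strong_induction_on with
  | _ u ih =>
    have h1 := sum_choose_mul_connProb p hp u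
    have h2 := sum_choose_mul_exploreProb p _ 1 u rfl
    rw [Finset.sum_range_succ] at h1 h2
    have h3 : ∑ s ∈ Finset.range u,
        (u.choose s : ℝ) * connProb p (s + 1) * (1 - p) ^ ((s + 1) * (u - s)) =
        ∑ s ∈ Finset.range u,
        (u.choose s : ℝ) * exploreProb p (1 + s) 1 * (1 - p) ^ ((1 + s) * (u - s)) := by
      refine Finset.sum_congr rfl fun s hs => ?_
      rw [ih s (Finset.mem_range.1 hs), add_comm 1 s]
    rw [h3] at h1
    simp only [Nat.choose_self, Nat.cast_one, one_mul, Nat.sub_self, mul_zero, pow_zero,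
      mul_one] at h1 h2
    rw [add_comm 1 u] at h2
    linarith

/-! ### Comparison with weighted forests -/

lemma sum_choose_mul_pow_mul_id (N : ℝ) (u : ℕ) :
    ∑ x ∈ Finset.range (u + 1), (u.choose x : ℝ) * N ^ (u - x) * x =
      u * (N + 1) ^ (u - 1) := by
  cases u with
  | zero => simp
  | succ u =>
    rw [Finset.sum_range_succ']
    simp only [Nat.cast_zero, mul_zero, add_zero, Nat.add_sub_cancel]
    rw [add_comm N 1, add_pow, Finset.mul_sum]
    refine Finset.sum_congr rfl fun x _ => ?_
    have h : ((u + 1 : ℕ) : ℝ) * (u.choose x : ℝ) =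
        ((u + 1).choose (x + 1) : ℝ) * ((x + 1 : ℕ) : ℝ) := by
      exact_mod_cast Nat.add_one_mul_choose_eq u x
    rw [show u + 1 - (x + 1) = u - x by omega, one_pow, one_mul]
    linear_combination (-(N ^ (u - x))) * h

/-- `a N^(N-a-1)` (with the exponent `-1` written as a division) counts the forests on `N` vertices
rooted at `a` given ones; this is the recursion obtained by removing a root. -/
lemma sum_choose_mul_forest (b u : ℕ) (hN : 0 < b + u) :
    ∑ x ∈ Finset.range (u + 1), (u.choose x : ℝ) *
        (((b + x : ℕ) : ℝ) * ((b + u : ℕ) : ℝ) ^ (u - x) / ((b + u : ℕ) : ℝ)) =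
      ((b + 1 : ℕ) : ℝ) * ((b + u + 1 : ℕ) : ℝ) ^ u / ((b + u + 1 : ℕ) : ℝ) := by
  have hN' : ((b + u : ℕ) : ℝ) ≠ 0 := by exact_mod_cast hN.ne'
  set N : ℝ := ((b + u : ℕ) : ℝ) with hNdef
  have h1 : ∑ x ∈ Finset.range (u + 1), (u.choose x : ℝ) * N ^ (u - x) = (N + 1) ^ u := by
    rw [add_comm N 1, add_pow]
    refine Finset.sum_congr rfl fun x _ => by rw [one_pow]; ring
  have h2 := sum_choose_mul_pow_mul_id N u
  have h3 : ∑ x ∈ Finset.range (u + 1), (u.choose x : ℝ) *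
      (((b + x : ℕ) : ℝ) * N ^ (u - x) / N) =
      (b * (N + 1) ^ u + u * (N + 1) ^ (u - 1)) / N := by
    rw [← h1, ← h2, Finset.mul_sum, ← Finset.sum_add_distrib, Finset.sum_div]
    refine Finset.sum_congr rfl fun x _ => ?_
    push_cast
    ring
  rw [h3]
  have hNpos : 0 < N := by rw [hNdef]; exact_mod_cast hN
  have h4 : ((b + u + 1 : ℕ) : ℝ) = N + 1 := by rw [hNdef]; push_cast; ring
  have hb : (b : ℝ) = N - u := by rw [hNdef]; push_cast; ring
  have h5 : (u : ℝ) * (N + 1) ^ u = u * (N + 1) ^ (u - 1) * (N + 1) := by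
    cases u with
    | zero => simp
    | succ u => rw [Nat.add_sub_cancel, pow_succ]; ring
  rw [h4]
  push_cast
  rw [hb, div_eq_div_iff hN' (by positivity)]
  linear_combination (-1 : ℝ) * h5

/-- A family `f` satisfying the recursion with weight `(1 - p)⁻¹` per active vertex as an
inequality bounds the exploration probability from above. -/
lemma exploreProb_le (p : ℝ) (hp0 : 0 ≤ p) (hp1 : p < 1) (f : ℕ → ℕ → ℝ) (K : ℕ)
    (h1 : 1 ≤ f 1 1) (hz : ∀ N, 0 ≤ f N 0)
    (hf : ∀ b u, 0 < b + u → b + u < K →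
      ∑ x ∈ Finset.range (u + 1), (u.choose x : ℝ) * ((1 - p)⁻¹ ^ (b + x) * f (b + u) (b + x)) ≤
        f (b + u + 1) (b + 1)) :
    ∀ N a, 1 ≤ N → N ≤ K → a ≤ N →
      exploreProb p N a ≤ p ^ (N - a) * (1 - p) ^ (N.choose 2) * f N a := by
  have hr : 0 < 1 - p := by linarith
  intro N
  induction N with
  | zero => intro a h; omega
  | succ N ih =>
    intro a _ hNK ha
    cases a with
    | zero =>
      rw [exploreProb]
      have := hz (N + 1)
      positivity
    | succ b =>
      rcases Nat.eq_zero_or_pos N with rfl | hN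
      · obtain rfl : b = 0 := by omega
        simpa [exploreProb] using h1
      obtain ⟨u, rfl⟩ := Nat.exists_eq_add_of_le (show b ≤ N by omega)
      rw [exploreProb_succ, show b + u - b = u by omega,
        show b + u + 1 - (b + 1) = u by omega]
      calc _ ≤ ∑ x ∈ Finset.range (u + 1), p ^ u * (1 - p) ^ ((b + u + 1).choose 2) *
            ((u.choose x : ℝ) * ((1 - p)⁻¹ ^ (b + x) * f (b + u) (b + x))) := by
            refine Finset.sum_le_sum fun x hx => ?_
            have hxu : x ≤ u := Nat.lt_succ_iff.1 (Finset.mem_range.1 hx)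
            have h := ih (b + x) hN (by omega) (by omega)
            calc _ ≤ (u.choose x : ℝ) * p ^ x * (1 - p) ^ (u - x) *
                (p ^ (b + u - (b + x)) * (1 - p) ^ ((b + u).choose 2) * f (b + u) (b + x)) :=
                  mul_le_mul_of_nonneg_left h (by positivity)
              _ = _ := by
                have e1 : p ^ u = p ^ x * p ^ (b + u - (b + x)) := by
                  rw [← pow_add]; congr 1; omega
                have e2 : (1 - p) ^ ((b + u + 1).choose 2) * (1 - p)⁻¹ ^ (b + x) =
                    (1 - p) ^ (u - x) * (1 - p) ^ ((b + u).choose 2) := by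
                  rw [choose_two_add (b + u) 1, inv_pow, ← div_eq_mul_inv, div_eq_iff (by positivity),
                    ← pow_add, ← pow_add]
                  congr 1
                  simp only [Nat.choose_succ_self, mul_one]
                  omega
                rw [e1]
                linear_combination (-(p ^ x * p ^ (b + u - (b + x)) * (u.choose x : ℝ) *
                  f (b + u) (b + x))) * e2
        _ ≤ _ := by
          rw [← Finset.mul_sum]
          exact mul_le_mul_of_nonneg_left (hf b u hN (by omega)) (by positivity)

/-- Replacing the weights `(1 - p)⁻¹ ^ (b + x)` by `1` leaves the recursion for forests. -/
lemma le_exploreProb (p : ℝ) (hp0 : 0 ≤ p) (hp1 : p < 1) :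
    ∀ N a : ℕ, 1 ≤ N → a ≤ N →
      p ^ (N - a) * (1 - p) ^ (N.choose 2) * (a * (N : ℝ) ^ (N - a) / N) ≤ exploreProb p N a := by
  have hr : 0 < 1 - p := by linarith
  intro N
  induction N with
  | zero => intro a h; omega
  | succ N ih =>
    intro a _ ha
    cases a with
    | zero => simp [exploreProb]
    | succ b =>
      rcases Nat.eq_zero_or_pos N with rfl | hN
      · obtain rfl : b = 0 := by omega
        simp [exploreProb]
      obtain ⟨u, rfl⟩ := Nat.exists_eq_add_of_le (show b ≤ N by omega)
      rw [exploreProb_succ, show b + u - b = u by omega,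
        show b + u + 1 - (b + 1) = u by omega, ← sum_choose_mul_forest b u hN, Finset.mul_sum]
      refine Finset.sum_le_sum fun x hx => ?_
      have hxu : x ≤ u := Nat.lt_succ_iff.1 (Finset.mem_range.1 hx)
      have h := ih (b + x) hN (by omega)
      have e1 : p ^ u = p ^ x * p ^ (b + u - (b + x)) := by
        rw [← pow_add]; congr 1; omega
      have e2 : (1 - p) ^ ((b + u + 1).choose 2) ≤
          (1 - p) ^ (u - x) * (1 - p) ^ ((b + u).choose 2) := by
        rw [← pow_add]
        refine pow_le_pow_of_le_one hr.le (by linarith) ?_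
        rw [choose_two_add (b + u) 1]
        simp only [Nat.choose_succ_self, mul_one]
        omega
      rw [show b + u - (b + x) = u - x by omega] at h e1
      set F : ℝ := ((b + x : ℕ) : ℝ) * ((b + u : ℕ) : ℝ) ^ (u - x) / ((b + u : ℕ) : ℝ) with hF
      have hF0 : 0 ≤ F := by positivity
      calc p ^ u * (1 - p) ^ ((b + u + 1).choose 2) * ((u.choose x : ℝ) * F)
          ≤ p ^ u * ((1 - p) ^ (u - x) * (1 - p) ^ ((b + u).choose 2)) *
            ((u.choose x : ℝ) * F) := by gcongr
        _ = (u.choose x : ℝ) * p ^ x * (1 - p) ^ (u - x) *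
            (p ^ (u - x) * (1 - p) ^ ((b + u).choose 2) * F) := by rw [e1]; ring
        _ ≤ _ := mul_le_mul_of_nonneg_left h (by positivity)

/-! ### Hyperbolic inequalities -/

lemma sinh_le_mul_cosh {x : ℝ} (hx : 0 ≤ x) : Real.sinh x ≤ x * Real.cosh x := by
  have hd : ∀ y : ℝ, HasDerivAt (fun y => y * Real.cosh y - Real.sinh y) (y * Real.sinh y) y := by
    intro y
    have := ((hasDerivAt_id y).mul (Real.hasDerivAt_cosh y)).sub (Real.hasDerivAt_sinh y)
    refine this.congr_deriv ?_
    simp only [id]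
    ring
  have hm : MonotoneOn (fun y => y * Real.cosh y - Real.sinh y) (Set.Ici (0 : ℝ)) := by
    refine monotoneOn_of_deriv_nonneg (convex_Ici 0) ?_ ?_ ?_
    · exact fun y _ => (hd y).continuousAt.continuousWithinAt
    · exact fun y _ => (hd y).differentiableAt.differentiableWithinAt
    · intro y hy
      rw [(hd y).deriv]
      have : 0 < y := by simpa using hy
      exact mul_nonneg this.le (Real.sinh_nonneg_iff.2 this.le)
  have := hm (Set.mem_Ici.2 le_rfl) (Set.mem_Ici.2 hx) hx
  simp at this
  linarith

lemma sinh_add_le {z δ : ℝ} (hz : 0 < z) (hδ : 0 ≤ δ) :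
    Real.sinh (z + δ) ≤ Real.exp (δ + δ / z) * Real.sinh z := by
  have hs : z ≤ Real.sinh z := Real.self_le_sinh_iff.2 hz.le
  have hs0 : 0 < Real.sinh z := lt_of_lt_of_le hz hs
  have h1 : Real.cosh z ≤ Real.sinh z * (1 + 1 / z) := by
    have h2 : Real.cosh z - Real.sinh z = Real.exp (-z) := Real.cosh_sub_sinh z
    have h3 : Real.exp (-z) ≤ 1 := Real.exp_le_one_iff.2 (by linarith)
    have h4 : 1 ≤ Real.sinh z * (1 / z) := by
      rw [mul_one_div, le_div_iff₀ hz]; linarith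
    linarith
  have hsd : 0 ≤ Real.sinh δ := Real.sinh_nonneg_iff.2 hδ
  have h5 : Real.sinh δ ≤ δ * Real.exp δ := by
    refine (sinh_le_mul_cosh hδ).trans (mul_le_mul_of_nonneg_left ?_ hδ)
    linarith [Real.cosh_add_sinh δ]
  have h6 : 1 + δ / z ≤ Real.exp (δ / z) := by linarith [Real.add_one_le_exp (δ / z)]
  calc Real.sinh (z + δ) = Real.sinh z * Real.cosh δ + Real.cosh z * Real.sinh δ := Real.sinh_add z δ
    _ ≤ Real.sinh z * Real.cosh δ + Real.sinh z * (1 + 1 / z) * Real.sinh δ := by gcongr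
    _ = Real.sinh z * ((Real.cosh δ + Real.sinh δ) + Real.sinh δ / z) := by ring
    _ ≤ Real.sinh z * (Real.exp δ + δ * Real.exp δ / z) := by
        rw [Real.cosh_add_sinh]; gcongr
    _ = Real.sinh z * (Real.exp δ * (1 + δ / z)) := by ring
    _ ≤ Real.sinh z * (Real.exp δ * Real.exp (δ / z)) := by gcongr
    _ = _ := by rw [Real.exp_add]; ring

lemma sinh_mul_le_mul_sinh {ρ y : ℝ} (h0 : 0 < ρ) (h1 : ρ ≤ 1) (hy : 0 ≤ y) :
    Real.sinh (ρ * y) ≤ ρ * Real.sinh y := by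
  set δ := y - ρ * y with hδ
  have hδ0 : 0 ≤ δ := by rw [hδ]; nlinarith
  have hz : 0 ≤ ρ * y := by positivity
  have e1 : Real.sinh y = Real.sinh (ρ * y) * Real.cosh δ + Real.cosh (ρ * y) * Real.sinh δ := by
    rw [← Real.sinh_add]; congr 1; rw [hδ]; ring
  have e2 : Real.sinh (ρ * y) ≤ Real.sinh (ρ * y) * Real.cosh δ :=
    le_mul_of_one_le_right (Real.sinh_nonneg_iff.2 hz) (Real.one_le_cosh δ)
  have e3 : Real.cosh (ρ * y) * δ ≤ Real.cosh (ρ * y) * Real.sinh δ :=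
    mul_le_mul_of_nonneg_left (Real.self_le_sinh_iff.2 hδ0) (Real.cosh_pos _).le
  have e4 := sinh_le_mul_cosh hz
  have e5 : ρ * (Real.cosh (ρ * y) * δ) = (1 - ρ) * (ρ * y * Real.cosh (ρ * y)) := by
    rw [hδ]; ring
  have e6 : (1 - ρ) * Real.sinh (ρ * y) ≤ (1 - ρ) * (ρ * y * Real.cosh (ρ * y)) :=
    mul_le_mul_of_nonneg_left e4 (by linarith)
  have e7 : ρ * (Real.sinh (ρ * y) + Real.cosh (ρ * y) * δ) ≤ ρ * Real.sinh y :=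
    mul_le_mul_of_nonneg_left (by linarith) h0.le
  nlinarith

lemma sinh_mul_le_exp_mul_sinh {ρ y : ℝ} (h1 : ρ ≤ 1) (hy : 0 ≤ y) :
    Real.sinh (ρ * y) ≤ Real.exp (-((1 - ρ) * y)) * Real.sinh y := by
  rw [Real.sinh_eq, Real.sinh_eq, mul_div_assoc', mul_sub, ← Real.exp_add, ← Real.exp_add]
  have h : Real.exp (-((1 - ρ) * y) + -y) ≤ Real.exp (-(ρ * y)) := by
    apply Real.exp_le_exp.2; nlinarith
  rw [show -((1 - ρ) * y) + y = ρ * y by ring]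
  linarith

/-- The contraction `y ↦ (1 - 1/m) y` gains a factor `1 - 1/m` on `sinh y` for small `y`, and an
additional exponential factor for large `y`, which pays for the exponential tilt. -/
lemma sinh_contract_le {N k : ℝ} (hN : 1 ≤ N) (hk : N + 1 ≤ k) {y : ℝ} (hy : 0 ≤ y) :
    Real.exp (y / (2 * k)) * Real.sinh (N / (N + 1) * y) ≤
      N / (N + 1) * Real.exp (2 / k) * Real.sinh y := by
  have hρ0 : 0 < N / (N + 1) := by positivity
  have hρ1 : N / (N + 1) ≤ 1 := by rw [div_le_one (by linarith)]; linarith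
  have hs : 0 ≤ Real.sinh y := Real.sinh_nonneg_iff.2 hy
  have hk0 : 0 < k := by linarith
  rcases le_total y 4 with h4 | h4
  · have h1 : y / (2 * k) ≤ 2 / k := by
      rw [div_le_div_iff₀ (by positivity) hk0]; nlinarith
    calc _ ≤ Real.exp (2 / k) * (N / (N + 1) * Real.sinh y) := by
          gcongr
          exact sinh_mul_le_mul_sinh hρ0 hρ1 hy
      _ = _ := by ring
  · have hρ : Real.exp (-(2 / (N + 1))) ≤ N / (N + 1) := by
      have h1 : 1 + 1 / N ≤ Real.exp (2 / (N + 1)) := by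
        have h2 : 1 / N ≤ 2 / (N + 1) := by
          rw [div_le_div_iff₀ (by linarith) (by linarith)]; linarith
        linarith [Real.add_one_le_exp (2 / (N + 1))]
      rw [Real.exp_neg, inv_le_comm₀ (Real.exp_pos _) hρ0]
      calc (N / (N + 1))⁻¹ = 1 + 1 / N := by field_simp
        _ ≤ _ := h1
    have h1 : Real.exp (y / (2 * k)) ≤ Real.exp (y / (N + 1) - 2 / (N + 1)) := by
      apply Real.exp_le_exp.2
      rw [← sub_div, div_le_div_iff₀ (by positivity) (by linarith)]
      nlinarith
    calc _ ≤ Real.exp (y / (N + 1) - 2 / (N + 1)) *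
          (Real.exp (-((1 - N / (N + 1)) * y)) * Real.sinh y) := by
          have := sinh_mul_le_exp_mul_sinh hρ1 hy
          have h0 : 0 ≤ Real.sinh (N / (N + 1) * y) := Real.sinh_nonneg_iff.2 (by positivity)
          gcongr
      _ = Real.exp (-(2 / (N + 1))) * Real.sinh y := by
          rw [← mul_assoc, ← Real.exp_add]
          congr 2
          field_simp
          ring
      _ ≤ N / (N + 1) * Real.sinh y := by gcongr
      _ ≤ N / (N + 1) * Real.exp (2 / k) * Real.sinh y := by
          have : 1 ≤ Real.exp (2 / k) := Real.one_le_exp (by positivity)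
          have h3 : N / (N + 1) ≤ N / (N + 1) * Real.exp (2 / k) := le_mul_of_one_le_right hρ0.le this
          gcongr

/-! ### The tilted binomial moment generating function -/

lemma sum_choose_mul_exp (N s : ℝ) (b u : ℕ) :
    ∑ x ∈ Finset.range (u + 1), (u.choose x : ℝ) * (N ^ (u - x) * Real.exp (s * ((b + x : ℕ) : ℝ))) =
      Real.exp (s * b) * (N + Real.exp s) ^ u := by
  rw [add_comm N, add_pow, Finset.mul_sum]
  refine Finset.sum_congr rfl fun x _ => ?_
  rw [← Real.exp_nat_mul]
  push_cast
  rw [show s * (b + x : ℝ) = s * b + x * s by ring, Real.exp_add]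
  ring

/-- The geometric mean of `N + e^(ε+θ)` and `N + e^(ε-θ)` is at most `(N + 1) e^(η/(N+1))`, with
`η = e^ε cosh θ - 1`. -/
lemma log_add_log_le {N ε θ : ℝ} (hN : 1 ≤ N) :
    (Real.log (N + Real.exp (ε + θ)) + Real.log (N + Real.exp (ε - θ))) / 2 ≤
      Real.log (N + 1) + (Real.exp ε * Real.cosh θ - 1) / (N + 1) := by
  set c := Real.exp ε * Real.cosh θ with hc
  have hc0 : 0 < c := mul_pos (Real.exp_pos _) (Real.cosh_pos _)
  have hA : 0 < N + Real.exp (ε + θ) := by positivity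
  have hB : 0 < N + Real.exp (ε - θ) := by positivity
  have hsum : Real.exp (ε + θ) + Real.exp (ε - θ) = 2 * c := by
    rw [hc, Real.cosh_eq, sub_eq_add_neg, Real.exp_add, Real.exp_add]; ring
  have h1 : Real.log (N + Real.exp (ε + θ)) + Real.log (N + Real.exp (ε - θ)) ≤
      2 * Real.log (N + c) := by
    rw [← Real.log_mul hA.ne' hB.ne', ← Real.log_rpow (by positivity)]
    apply Real.log_le_log (by positivity)
    norm_num
    nlinarith [sq_nonneg (Real.exp (ε + θ) - Real.exp (ε - θ))]
  have h2 : Real.log (N + c) ≤ Real.log (N + 1) + (c - 1) / (N + 1) := by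
    have h3 : N + c = (N + 1) * ((N + c) / (N + 1)) := by field_simp
    have h4 := Real.log_le_sub_one_of_pos (x := (N + c) / (N + 1)) (by positivity)
    rw [h3, Real.log_mul (by positivity) (by positivity)]
    have h5 : (N + c) / (N + 1) - 1 = (c - 1) / (N + 1) := by field_simp; ring
    linarith
  linarith

/-- Uses `w ≤ sinh w` for `w` half the logarithm of the quotient. -/
lemma log_sub_log_le {N ε θ : ℝ} (hN : 1 ≤ N) (hε : 0 ≤ ε) (hθ : 0 ≤ θ) :
    (Real.log (N + Real.exp (ε + θ)) - Real.log (N + Real.exp (ε - θ))) / 2 ≤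
      Real.exp ε * Real.sinh θ / (N + 1) := by
  set A := N + Real.exp (ε + θ) with hAdef
  set B := N + Real.exp (ε - θ) with hBdef
  have hA : 0 < A := by positivity
  have hB : 0 < B := by positivity
  have hBA : B ≤ A := by
    rw [hAdef, hBdef]; gcongr; linarith
  set w := (Real.log A - Real.log B) / 2 with hw
  have hw0 : 0 ≤ w := by
    have := Real.log_le_log hB hBA
    rw [hw]; linarith
  have h1 : w ≤ Real.sinh w := Real.self_le_sinh_iff.2 hw0
  have hdiff : A - B = 2 * (Real.exp ε * Real.sinh θ) := by
    rw [hAdef, hBdef, Real.sinh_eq, sub_eq_add_neg ε, Real.exp_add, Real.exp_add]; ring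
  have hsum : Real.exp (ε + θ) + Real.exp (ε - θ) = 2 * (Real.exp ε * Real.cosh θ) := by
    rw [Real.cosh_eq, sub_eq_add_neg, Real.exp_add, Real.exp_add]; ring
  have hprod : Real.exp (ε + θ) * Real.exp (ε - θ) = Real.exp ε * Real.exp ε := by
    rw [← Real.exp_add, ← Real.exp_add]; congr 1; ring
  have he1 : 1 ≤ Real.exp ε := Real.one_le_exp hε
  have hAB : (N + 1) ^ 2 ≤ A * B := by
    have hc1 : 1 ≤ Real.exp ε * Real.cosh θ :=
      one_le_mul_of_one_le_of_one_le he1 (Real.one_le_cosh θ)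
    have : A * B = N ^ 2 + N * (2 * (Real.exp ε * Real.cosh θ)) + Real.exp ε * Real.exp ε := by
      rw [← hprod, ← hsum, hAdef, hBdef]; ring
    rw [this]
    nlinarith
  set g := Real.exp ((Real.log A + Real.log B) / 2) with hg
  have hg0 : 0 < g := Real.exp_pos _
  have hg2 : g ^ 2 = A * B := by
    rw [hg, ← Real.exp_nat_mul]
    push_cast
    rw [show (2 : ℝ) * ((Real.log A + Real.log B) / 2) = Real.log A + Real.log B by ring,
      Real.exp_add, Real.exp_log hA, Real.exp_log hB]
  have hgN : N + 1 ≤ g := by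
    have : (N + 1) ^ 2 ≤ g ^ 2 := by rw [hg2]; exact hAB
    exact (pow_le_pow_iff_left₀ (by linarith) hg0.le two_ne_zero).1 this
  have h2 : Real.sinh w * g = (A - B) / 2 := by
    rw [Real.sinh_eq, hg, div_mul_eq_mul_div, sub_mul, ← Real.exp_add, ← Real.exp_add, hw,
      show (Real.log A - Real.log B) / 2 + (Real.log A + Real.log B) / 2 = Real.log A by ring,
      show -((Real.log A - Real.log B) / 2) + (Real.log A + Real.log B) / 2 = Real.log B by ring,
      Real.exp_log hA, Real.exp_log hB]
  rw [le_div_iff₀ (by linarith)]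
  calc w * (N + 1) ≤ Real.sinh w * g := mul_le_mul h1 hgN (by linarith) (hw0.trans h1)
    _ = _ := by rw [h2, hdiff]; ring

/-- Up to the factor `(N+1)^u`, the left side is `E[e^(εY) sinh(θY)]` for `Y = b + X`
with `X` binomial with `u` trials of success probability `1/(N+1)`. As the mean of `Y` is
`N/(N+1) * (b+1)`, the right side is nearly `sinh` at `θ` times the mean. -/
lemma sub_mgf_le {ε θ : ℝ} (hε : 0 ≤ ε) (hθ : 0 ≤ θ) (b u : ℕ) (hN : 0 < b + u) {N : ℝ}
    (hNdef : N = ((b + u : ℕ) : ℝ)) :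
    (Real.exp ((ε + θ) * b) * (N + Real.exp (ε + θ)) ^ u -
      Real.exp ((ε - θ) * b) * (N + Real.exp (ε - θ)) ^ u) / 2 ≤
    (N + 1) ^ u * Real.exp (ε * b + (Real.exp ε * Real.cosh θ - 1)) *
      Real.sinh (N / (N + 1) * (θ * (b + 1)) + θ * (Real.exp ε * Real.cosh θ - 1)) := by
  have hN1 : 1 ≤ N := by rw [hNdef]; exact_mod_cast hN
  have hub : (u : ℝ) = N - b := by rw [hNdef]; push_cast; ring
  have hu0 : (0 : ℝ) ≤ u := Nat.cast_nonneg u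
  have hb0 : (0 : ℝ) ≤ b := Nat.cast_nonneg b
  have hA : 0 < N + Real.exp (ε + θ) := by positivity
  have hB : 0 < N + Real.exp (ε - θ) := by positivity
  have hm := log_add_log_le (ε := ε) (θ := θ) hN1
  have hd := log_sub_log_le hN1 hε hθ
  set α := Real.log (N + Real.exp (ε + θ)) with hα
  set α' := Real.log (N + Real.exp (ε - θ)) with hα'
  set η := Real.exp ε * Real.cosh θ - 1 with hη
  have hη0 : 0 ≤ η := by
    have := one_le_mul_of_one_le_of_one_le (Real.one_le_exp hε) (Real.one_le_cosh θ)
    rw [hη]; linarith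
  have huN : u / (N + 1) ≤ 1 := by rw [div_le_one (by linarith)]; linarith
  have hX : Real.exp ((ε + θ) * b) * (N + Real.exp (ε + θ)) ^ u =
      Real.exp (ε * b + u * ((α + α') / 2)) * Real.exp (θ * b + u * ((α - α') / 2)) := by
    rw [← Real.exp_log hA, ← Real.exp_nat_mul, ← Real.exp_add, ← Real.exp_add]
    congr 1; ring
  have hY : Real.exp ((ε - θ) * b) * (N + Real.exp (ε - θ)) ^ u =
      Real.exp (ε * b + u * ((α + α') / 2)) * Real.exp (-(θ * b + u * ((α - α') / 2))) := by
    rw [← Real.exp_log hB, ← Real.exp_nat_mul, ← Real.exp_add, ← Real.exp_add]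
    congr 1; ring
  have hXY : (Real.exp ((ε + θ) * b) * (N + Real.exp (ε + θ)) ^ u -
      Real.exp ((ε - θ) * b) * (N + Real.exp (ε - θ)) ^ u) / 2 =
      Real.exp (ε * b + u * ((α + α') / 2)) * Real.sinh (θ * b + u * ((α - α') / 2)) := by
    rw [hX, hY, Real.sinh_eq]; ring
  have h1 : ε * b + u * ((α + α') / 2) ≤ u * Real.log (N + 1) + (ε * b + η) := by
    have e1 := mul_le_mul_of_nonneg_left hm hu0
    have e2 : u * (Real.log (N + 1) + η / (N + 1)) = u * Real.log (N + 1) + u / (N + 1) * η := by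
      ring
    have e3 : u / (N + 1) * η ≤ 1 * η := mul_le_mul_of_nonneg_right huN hη0
    linarith
  have h2 : θ * b + u * ((α - α') / 2) ≤ N / (N + 1) * (θ * (b + 1)) + θ * η := by
    have e1 := mul_le_mul_of_nonneg_left hd hu0
    have e2 : u * (Real.exp ε * Real.sinh θ / (N + 1)) = u / (N + 1) * (Real.exp ε * Real.sinh θ) := by
      ring
    have e3 : Real.exp ε * Real.sinh θ ≤ θ + θ * η := by
      have := mul_le_mul_of_nonneg_left (sinh_le_mul_cosh hθ) (Real.exp_pos ε).le
      rw [hη]; linarith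
    have e4 := mul_le_mul_of_nonneg_left e3 (show 0 ≤ u / (N + 1) by positivity)
    have e5 : u / (N + 1) * (θ * η) ≤ 1 * (θ * η) :=
      mul_le_mul_of_nonneg_right huN (by positivity)
    have e6 : θ * b + u / (N + 1) * θ = N / (N + 1) * (θ * (b + 1)) := by
      rw [hub]; field_simp; ring
    linarith
  have h3 : 0 ≤ N / (N + 1) * (θ * (b + 1)) + θ * η := by positivity
  rw [hXY]
  calc _ ≤ Real.exp (u * Real.log (N + 1) + (ε * b + η)) *
        Real.sinh (N / (N + 1) * (θ * (b + 1)) + θ * η) := by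
        have e1 := Real.sinh_le_sinh.2 h2
        have e2 := Real.exp_le_exp.2 h1
        have e3 := Real.sinh_nonneg_iff.2 h3
        exact (mul_le_mul_of_nonneg_left e1 (Real.exp_pos _).le).trans
          (mul_le_mul_of_nonneg_right e2 e3)
    _ = _ := by
        rw [Real.exp_add, Real.exp_nat_mul, Real.exp_log (by linarith)]

/-- `a ↦ N^(N-a-1) e^(βN/k) sinh(θ a)` is a supersolution of the weighted exploration recursion. -/
lemma sum_choose_mul_sinh_le {ε θ β : ℝ} {k : ℕ} (hε : 0 ≤ ε) (hθ : 0 < θ) (b u : ℕ)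
    (hN : 0 < b + u) (hk : b + u < k) (hεθ : ε ≤ θ / (2 * k))
    (hβ : (3 + θ) * (Real.exp ε * Real.cosh θ - 1) * k + 2 ≤ β) :
    ∑ x ∈ Finset.range (u + 1), (u.choose x : ℝ) * (Real.exp ε ^ (b + x) *
        (((b + u : ℕ) : ℝ) ^ (u - x) / ((b + u : ℕ) : ℝ) * Real.sinh (θ * ((b + x : ℕ) : ℝ)))) ≤
      ((b + u + 1 : ℕ) : ℝ) ^ u / ((b + u + 1 : ℕ) : ℝ) * Real.exp (β / k) *
        Real.sinh (θ * ((b + 1 : ℕ) : ℝ)) := by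
  set N : ℝ := ((b + u : ℕ) : ℝ) with hNdef
  have hN1 : 1 ≤ N := by rw [hNdef]; exact_mod_cast hN
  have hNk : N + 1 ≤ k := by rw [hNdef]; exact_mod_cast hk
  have hk0 : (0 : ℝ) < k := by linarith
  have hN0 : 0 < N := by linarith
  set η := Real.exp ε * Real.cosh θ - 1 with hη
  have hη0 : 0 ≤ η := by
    have := one_le_mul_of_one_le_of_one_le (Real.one_le_exp hε) (Real.one_le_cosh θ)
    rw [hη]; linarith
  have hsum : ∑ x ∈ Finset.range (u + 1), (u.choose x : ℝ) * (Real.exp ε ^ (b + x) *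
        (N ^ (u - x) / N * Real.sinh (θ * ((b + x : ℕ) : ℝ)))) =
      ((Real.exp ((ε + θ) * b) * (N + Real.exp (ε + θ)) ^ u -
      Real.exp ((ε - θ) * b) * (N + Real.exp (ε - θ)) ^ u) / 2) / N := by
    rw [← sum_choose_mul_exp, ← sum_choose_mul_exp, ← Finset.sum_sub_distrib, Finset.sum_div,
      Finset.sum_div]
    refine Finset.sum_congr rfl fun x _ => ?_
    rw [Real.sinh_eq, ← Real.exp_nat_mul, add_mul, sub_eq_add_neg ε, add_mul, Real.exp_add,
      Real.exp_add, neg_mul, mul_comm ε]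
    ring
  have h1 := sub_mgf_le hε hθ.le b u hN hNdef
  rw [← hη] at h1
  set y := θ * ((b : ℝ) + 1) with hy
  have hyθ : θ ≤ y := by
    rw [hy]; exact le_mul_of_one_le_right hθ.le (by linarith [Nat.cast_nonneg (α := ℝ) b])
  have hy0 : 0 < y := by linarith
  have hρ : 1 / 2 ≤ N / (N + 1) := by
    rw [div_le_div_iff₀ (by norm_num) (by linarith)]; linarith
  have hz : θ / 2 ≤ N / (N + 1) * y := by
    calc θ / 2 = 1 / 2 * θ := by ring
      _ ≤ _ := by gcongr
  have h2 := sinh_add_le (z := N / (N + 1) * y) (δ := θ * η) (by linarith) (by positivity)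
  have h3 : θ * η / (N / (N + 1) * y) ≤ 2 * η := by
    rw [div_le_iff₀ (by linarith)]
    nlinarith
  have h4 := sinh_contract_le hN1 hNk hy0.le
  have h5 : ε * b ≤ y / (2 * k) := by
    calc ε * b ≤ θ / (2 * k) * b := by gcongr
      _ ≤ θ / (2 * k) * (b + 1) := by gcongr; linarith
      _ = _ := by rw [hy]; ring
  have hs0 : 0 ≤ Real.sinh (N / (N + 1) * y) := Real.sinh_nonneg_iff.2 (by linarith)
  have hsy : 0 ≤ Real.sinh y := Real.sinh_nonneg_iff.2 hy0.le
  have hβ' : η + (θ * η + 2 * η) + 2 / k ≤ β / k := by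
    have e : (η + (θ * η + 2 * η) + 2 / k) * k = (3 + θ) * η * k + 2 := by field_simp; ring
    rw [le_div_iff₀ hk0, e]
    exact hβ
  rw [hsum, div_le_iff₀ hN0]
  have hcast1 : ((b + u + 1 : ℕ) : ℝ) = N + 1 := by rw [hNdef]; push_cast; ring
  have hcast2 : θ * ((b + 1 : ℕ) : ℝ) = y := by rw [hy]; push_cast; ring
  rw [hcast1, hcast2]
  refine h1.trans ?_
  calc (N + 1) ^ u * Real.exp (ε * b + η) * Real.sinh (N / (N + 1) * y + θ * η)
      ≤ (N + 1) ^ u * Real.exp (y / (2 * k) + η) *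
        (Real.exp (θ * η + 2 * η) * Real.sinh (N / (N + 1) * y)) := by
        have e1 : Real.exp (ε * b + η) ≤ Real.exp (y / (2 * k) + η) :=
          Real.exp_le_exp.2 (by linarith)
        have e2 : Real.exp (θ * η + θ * η / (N / (N + 1) * y)) ≤ Real.exp (θ * η + 2 * η) :=
          Real.exp_le_exp.2 (by linarith)
        have e3 := h2.trans (mul_le_mul_of_nonneg_right e2 hs0)
        have e4 : 0 ≤ Real.sinh (N / (N + 1) * y + θ * η) :=
          Real.sinh_nonneg_iff.2 (by have : 0 ≤ θ * η := by positivity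
                                     linarith)
        gcongr
    _ = (N + 1) ^ u * Real.exp (η + (θ * η + 2 * η)) *
        (Real.exp (y / (2 * k)) * Real.sinh (N / (N + 1) * y)) := by
        rw [Real.exp_add, Real.exp_add η]; ring
    _ ≤ (N + 1) ^ u * Real.exp (η + (θ * η + 2 * η)) *
        (N / (N + 1) * Real.exp (2 / k) * Real.sinh y) := by gcongr
    _ = (N + 1) ^ u / (N + 1) * Real.exp (η + (θ * η + 2 * η) + 2 / k) * Real.sinh y * N := by
        rw [Real.exp_add _ (2 / (k : ℝ))]; ring
    _ ≤ (N + 1) ^ u / (N + 1) * Real.exp (β / k) * Real.sinh y * N := by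
        have := Real.exp_le_exp.2 hβ'
        gcongr

/-! ### Two-sided bounds for the connectedness probability -/

/-- The left side is `(1 - p)^(k-1)` times the probability that the random graph is a tree. -/
lemma le_connProb (p : ℝ) (hp0 : 0 ≤ p) (hp1 : p < 1) (k : ℕ) (hk : 1 ≤ k) :
    p ^ (k - 1) * (1 - p) ^ (k.choose 2) * ((k : ℝ) ^ (k - 1) / k) ≤ connProb p k := by
  obtain ⟨u, rfl⟩ := Nat.exists_eq_add_of_le' hk
  rw [connProb_eq_exploreProb p ⟨hp0, hp1.le⟩]
  have := le_exploreProb p hp0 hp1 (u + 1) 1 (by omega) (by omega)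
  simpa using this

/-- Within the critical window, graphs with cycles contribute at most a constant factor. -/
lemma connProb_le (c : ℝ) (hc : 0 < c) : ∃ C : ℝ, 0 < C ∧ ∀ (p : ℝ) (k : ℕ), 0 ≤ p → p < 1 →
    1 ≤ k → -Real.log (1 - p) * ((k : ℝ) * √k) ≤ c →
    connProb p k ≤ C * (p ^ (k - 1) * (1 - p) ^ (k.choose 2) * ((k : ℝ) ^ (k - 1) / k)) := by
  set τ := c + (2 * c) ^ 2 / 2 with hτ
  set β := (3 + 2 * c) * (Real.exp τ - 1) + 2 with hβ
  have hτ0 : 0 < τ := by positivity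
  refine ⟨Real.exp β, Real.exp_pos β, ?_⟩
  intro p k hp0 hp1 hk hpk
  set ε := -Real.log (1 - p) with hεdef
  have hr : 0 < 1 - p := by linarith
  have hε : 0 ≤ ε := by
    have := Real.log_nonpos hr.le (by linarith)
    rw [hεdef]; linarith
  have hk1 : (1 : ℝ) ≤ k := by exact_mod_cast hk
  have hsq : 1 ≤ √(k : ℝ) := Real.one_le_sqrt.2 hk1
  have hsq0 : 0 < √(k : ℝ) := by linarith
  have hsqk : √(k : ℝ) * √k = k := Real.mul_self_sqrt (by linarith)
  set θ := 2 * c / √k with hθdef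
  have hθ : 0 < θ := by positivity
  have hθc : θ ≤ 2 * c := div_le_self (by positivity) hsq
  have hεθ : ε ≤ θ / (2 * k) := by
    rw [hθdef, div_div, le_div_iff₀ (by positivity)]
    nlinarith
  have hετ : ε + θ ^ 2 / 2 ≤ τ / k := by
    have e1 : ε ≤ c / k := by
      rw [le_div_iff₀ (by linarith)]
      refine le_trans ?_ hpk
      refine mul_le_mul_of_nonneg_left ?_ hε
      exact le_mul_of_one_le_right (by linarith) hsq
    have e2 : θ ^ 2 / 2 = (2 * c) ^ 2 / 2 / k := by
      rw [hθdef, div_pow, Real.sq_sqrt (by linarith)]; ring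
    rw [e2, hτ, add_div]
    linarith
  have hη : (Real.exp ε * Real.cosh θ - 1) * k ≤ Real.exp τ - 1 := by
    have e1 : Real.exp ε * Real.cosh θ ≤ Real.exp (τ / k) := by
      calc _ ≤ Real.exp ε * Real.exp (θ ^ 2 / 2) := by
            gcongr; exact Real.cosh_le_exp_half_sq θ
        _ ≤ _ := by rw [← Real.exp_add]; exact Real.exp_le_exp.2 hετ
    -- convexity of the exponential on `[0, τ]`, as Bernoulli's inequality
    have e2 : 1 + k * (Real.exp (τ / k) - 1) ≤ Real.exp τ := by
      have h := one_add_mul_le_pow (a := Real.exp (τ / k) - 1)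
        (by linarith [Real.exp_pos (τ / k)]) k
      rw [add_sub_cancel, ← Real.exp_nat_mul, mul_div_cancel₀ τ (by linarith)] at h
      exact h
    have e3 : (Real.exp ε * Real.cosh θ - 1) * k ≤ (Real.exp (τ / k) - 1) * k := by gcongr
    linarith
  have hη0 : 0 ≤ (Real.exp ε * Real.cosh θ - 1) * k := by
    have := one_le_mul_of_one_le_of_one_le (Real.one_le_exp hε) (Real.one_le_cosh θ)
    exact mul_nonneg (by linarith) (by linarith)
  have hβ' : (3 + θ) * (Real.exp ε * Real.cosh θ - 1) * k + 2 ≤ β := by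
    rw [hβ, mul_assoc]
    have : (3 + θ) * ((Real.exp ε * Real.cosh θ - 1) * k) ≤
        (3 + 2 * c) * (Real.exp τ - 1) := mul_le_mul (by linarith) hη hη0 (by linarith)
    linarith
  have hβ0 : 0 ≤ β := by
    have := Real.add_one_le_exp τ
    have : 0 ≤ (3 + 2 * c) * (Real.exp τ - 1) := mul_nonneg (by positivity) (by linarith)
    rw [hβ]; linarith
  have hinv : (1 - p)⁻¹ = Real.exp ε := by
    rw [hεdef, Real.exp_neg, Real.exp_log hr]
  have hsθ : 0 < Real.sinh θ := Real.sinh_pos_iff.2 hθ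
  let f : ℕ → ℕ → ℝ := fun N a =>
    (N : ℝ) ^ (N - a) / N * Real.sinh (θ * a) * (Real.exp (β * N / k) / Real.sinh θ)
  have hmain := exploreProb_le p hp0 hp1 f k (by
      simp only [f]
      norm_num
      rw [mul_div_cancel₀ _ hsθ.ne']
      exact Real.one_le_exp (by positivity)) (fun N => by simp [f]) (by
      intro b u hN hbk
      have h := sum_choose_mul_sinh_le hε hθ b u hN hbk hεθ hβ'
      have hE : Real.exp (β * ((b + u + 1 : ℕ) : ℝ) / k) =
          Real.exp (β * ((b + u : ℕ) : ℝ) / k) * Real.exp (β / k) := by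
        rw [← Real.exp_add]; congr 1; push_cast; ring
      have hfac : 0 ≤ Real.exp (β * ((b + u : ℕ) : ℝ) / k) / Real.sinh θ := by positivity
      calc _ = (∑ x ∈ Finset.range (u + 1), (u.choose x : ℝ) * (Real.exp ε ^ (b + x) *
            (((b + u : ℕ) : ℝ) ^ (u - x) / ((b + u : ℕ) : ℝ) *
              Real.sinh (θ * ((b + x : ℕ) : ℝ))))) *
            (Real.exp (β * ((b + u : ℕ) : ℝ) / k) / Real.sinh θ) := by
            rw [Finset.sum_mul]
            refine Finset.sum_congr rfl fun x _ => ?_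
            simp only [f, hinv, show b + u - (b + x) = u - x by omega]
            ring
        _ ≤ _ := mul_le_mul_of_nonneg_right h hfac
        _ = f (b + u + 1) (b + 1) := by
            simp only [f, hE, show b + u + 1 - (b + 1) = u by omega]
            ring) k 1 hk le_rfl hk
  have hconn : connProb p k = exploreProb p k 1 := by
    obtain ⟨u, rfl⟩ := Nat.exists_eq_add_of_le' hk
    exact connProb_eq_exploreProb p ⟨hp0, hp1.le⟩ u
  rw [hconn]
  refine hmain.trans (le_of_eq ?_)
  simp only [f, Nat.cast_one, mul_one]
  rw [mul_div_cancel_right₀ β (by linarith : (k : ℝ) ≠ 0)]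
  field_simp

/-! ### Asymptotics of the tree term -/

/-- Stirling's formula, up to a bounded factor. -/
lemma abs_log_tree_sub_le (k : ℕ) (hk : 1 ≤ k) :
    |Real.log ((k : ℝ) ^ (k - 1) / (k.factorial : ℝ)) - (k - 3 / 2 * Real.log k)| ≤ 2 := by
  have hk0 : (0 : ℝ) < k := by exact_mod_cast hk
  have hs : Real.log (Stirling.stirlingSeq k) =
      Real.log k.factorial - 1 / 2 * Real.log (2 * k) - k * Real.log (k / Real.exp 1) :=
    Stirling.log_stirlingSeq_formula k
  have hlow : 0 ≤ Real.log (Stirling.stirlingSeq k) := by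
    refine Real.log_nonneg (le_trans ?_ (Stirling.sqrt_pi_le_stirlingSeq (by omega)))
    exact Real.one_le_sqrt.2 (by linarith [Real.pi_gt_three])
  have hup : Real.log (Stirling.stirlingSeq k) ≤ 1 := by
    obtain ⟨u, rfl⟩ := Nat.exists_eq_add_of_le' hk
    have h1 : Stirling.stirlingSeq (u + 1) ≤ Stirling.stirlingSeq 1 :=
      Stirling.stirlingSeq'_antitone (Nat.zero_le u)
    have h2 : Stirling.stirlingSeq 1 ≤ Real.exp 1 := by
      rw [Stirling.stirlingSeq_one]
      exact div_le_self (Real.exp_pos 1).le (Real.one_le_sqrt.2 (by norm_num))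
    calc _ ≤ Real.log (Real.exp 1) :=
          Real.log_le_log (Stirling.stirlingSeq'_pos u) (h1.trans h2)
      _ = 1 := Real.log_exp 1
  rw [Real.log_mul (by norm_num) hk0.ne', Real.log_div hk0.ne' (Real.exp_pos 1).ne',
    Real.log_exp] at hs
  rw [Real.log_div (by positivity) (by positivity), Real.log_pow, Nat.cast_sub hk, Nat.cast_one]
  have hl2 : 0 ≤ Real.log 2 := Real.log_nonneg (by norm_num)
  have hl2' : Real.log 2 ≤ 1 := by linarith [Real.log_two_lt_d9]
  rw [abs_le]
  constructor <;> nlinarith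

lemma abs_log_one_sub_add_le {t B : ℝ} (h0 : 0 ≤ t) (h1 : t < 1) (hB : (1 - t)⁻¹ ≤ B) :
    |Real.log (1 - t) + t| ≤ B * t ^ 2 := by
  have h := Real.abs_log_sub_add_sum_range_le (x := t) (by rwa [abs_of_nonneg h0]) 1
  simp only [Finset.sum_range_one, Nat.cast_zero, zero_add, pow_one, div_one,
    abs_of_nonneg h0] at h
  rw [add_comm]
  refine h.trans ?_
  rw [div_eq_mul_inv, mul_comm]
  exact mul_le_mul_of_nonneg_right hB (by positivity)

lemma abs_log_one_sub_add_add_le {t B : ℝ} (h1 : |t| < 1) (hB : (1 - |t|)⁻¹ ≤ B) :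
    |Real.log (1 - t) + t + t ^ 2 / 2| ≤ B * |t| ^ 3 := by
  have h := Real.abs_log_sub_add_sum_range_le (x := t) h1 2
  rw [Finset.sum_range_succ, Finset.sum_range_one] at h
  norm_num at h
  rw [show Real.log (1 - t) + t + t ^ 2 / 2 = t + t ^ 2 / 2 + Real.log (1 - t) by ring]
  refine h.trans ?_
  rw [div_eq_mul_inv, mul_comm]
  exact mul_le_mul_of_nonneg_right hB (by positivity)

lemma sum_range_cast_div (k : ℕ) (n : ℝ) :
    ∑ i ∈ Finset.range k, ((i : ℝ) / n + ((i : ℝ) / n) ^ 2 / 2) =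
      k * (k - 1) / 2 / n + (k - 1) * k * (2 * k - 1) / 12 / n ^ 2 := by
  induction k with
  | zero => simp
  | succ k ih =>
    rw [Finset.sum_range_succ, ih]
    push_cast
    ring

/-- The constant `2 + 8A` covers both `i ≤ n/2` and the case `k > n/2`, where `n ≤ 8A`. -/
lemma abs_sum_log_one_sub_le {A : ℝ} (hA : 0 ≤ A) {n k : ℕ} (hk : 1 ≤ k) (hkn : k ≤ n)
    (hkA : (k : ℝ) ^ 3 ≤ A * (n : ℝ) ^ 2) :
    |∑ i ∈ Finset.range k, Real.log (1 - (i : ℝ) / n) +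
      ((k : ℝ) ^ 2 / (2 * n) + (k : ℝ) ^ 3 / (6 * (n : ℝ) ^ 2))| ≤ (2 + 8 * A) * A + 1 := by
  have hn0 : (0 : ℝ) < n := by exact_mod_cast (by omega : 0 < n)
  have hk1 : (1 : ℝ) ≤ k := by exact_mod_cast hk
  have hkn' : (k : ℝ) ≤ n := by exact_mod_cast hkn
  have hterm : ∀ i ∈ Finset.range k,
      |Real.log (1 - (i : ℝ) / n) + ((i : ℝ) / n + ((i : ℝ) / n) ^ 2 / 2)| ≤
        (2 + 8 * A) * ((k : ℝ) / n) ^ 3 := by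
    intro i hi
    have hik : i < k := Finset.mem_range.1 hi
    have hik' : (i : ℝ) + 1 ≤ k := by exact_mod_cast hik
    have hi0 : (0 : ℝ) ≤ i := Nat.cast_nonneg i
    have ht0 : 0 ≤ (i : ℝ) / n := by positivity
    have ht1 : (i : ℝ) / n < 1 := by rw [div_lt_one hn0]; linarith
    have hinv : (1 - |(i : ℝ) / n|)⁻¹ ≤ 2 + 8 * A := by
      rw [abs_of_nonneg ht0, one_sub_div hn0.ne', inv_div, div_le_iff₀ (by linarith)]
      rcases le_total (2 * (i : ℝ)) n with h | h
      · nlinarith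
      · have h8 : (n : ℝ) ≤ 8 * A := by
          have h1 : (n : ℝ) ^ 3 ≤ (2 * k) ^ 3 := by
            apply pow_le_pow_left₀ hn0.le; linarith
          have h2 : (n : ℝ) * (n : ℝ) ^ 2 ≤ (8 * A) * (n : ℝ) ^ 2 := by nlinarith
          exact le_of_mul_le_mul_right h2 (by positivity)
        nlinarith
    have h := abs_log_one_sub_add_add_le (t := (i : ℝ) / n) (by rwa [abs_of_nonneg ht0]) hinv
    rw [add_assoc] at h
    refine h.trans ?_
    rw [abs_of_nonneg ht0]
    gcongr
  have hsum := (Finset.abs_sum_le_sum_abs _ _).trans (Finset.sum_le_sum hterm)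
  rw [Finset.sum_add_distrib, sum_range_cast_div, Finset.sum_const, Finset.card_range,
    nsmul_eq_mul] at hsum
  have hkn1 : (k : ℝ) / n ≤ 1 := by rw [div_le_one hn0]; exact hkn'
  have hkn0 : 0 ≤ (k : ℝ) / n := by positivity
  have hb : (k : ℝ) * ((2 + 8 * A) * ((k : ℝ) / n) ^ 3) ≤ (2 + 8 * A) * A := by
    have e : (k : ℝ) * ((2 + 8 * A) * ((k : ℝ) / n) ^ 3) =
        (2 + 8 * A) * ((k : ℝ) ^ 3 / (n : ℝ) ^ 2 * ((k : ℝ) / n)) := by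
      field_simp
    have e2 : (k : ℝ) ^ 3 / (n : ℝ) ^ 2 ≤ A := by
      rw [div_le_iff₀ (by positivity)]; exact hkA
    have e3 : (k : ℝ) ^ 3 / (n : ℝ) ^ 2 * ((k : ℝ) / n) ≤ A * 1 :=
      mul_le_mul e2 hkn1 hkn0 hA
    rw [e]
    have : 0 ≤ 2 + 8 * A := by linarith
    nlinarith
  have hd : (k : ℝ) ^ 2 / (2 * n) + (k : ℝ) ^ 3 / (6 * (n : ℝ) ^ 2) -
      (k * (k - 1) / 2 / n + (k - 1) * k * (2 * k - 1) / 12 / (n : ℝ) ^ 2) =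
      1 / 2 * ((k : ℝ) / n) + 1 / 4 * ((k : ℝ) / n) ^ 2 - 1 / 12 * ((k : ℝ) / n) * (1 / n) := by
    field_simp
    ring
  have hn1 : 1 / (n : ℝ) ≤ 1 := by rw [div_le_one hn0]; linarith
  have hn1' : 0 ≤ 1 / (n : ℝ) := by positivity
  have hd2 : |(k : ℝ) ^ 2 / (2 * n) + (k : ℝ) ^ 3 / (6 * (n : ℝ) ^ 2) -
      (k * (k - 1) / 2 / n + (k - 1) * k * (2 * k - 1) / 12 / (n : ℝ) ^ 2)| ≤ 1 := by
    rw [hd, abs_le]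
    constructor <;> nlinarith [mul_nonneg hkn0 hn1', mul_le_mul hkn1 hn1 hn1' zero_le_one]
  rw [abs_le] at hsum hd2 ⊢
  constructor <;> linarith [hsum.1, hsum.2, hd2.1, hd2.2]

lemma choose_mul_pow_eq (n k : ℕ) (hk : 1 ≤ k) (hkn : k ≤ n) (x : ℝ) :
    ((n - 1).choose (k - 1) : ℝ) * ((1 + x) / n) ^ (k - 1) * ((k : ℝ) ^ (k - 1) / k) =
      (∏ i ∈ Finset.range k, (1 - (i : ℝ) / n)) * (1 + x) ^ (k - 1) *
        ((k : ℝ) ^ (k - 1) / (k.factorial : ℝ)) := by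
  obtain ⟨j, rfl⟩ := Nat.exists_eq_add_of_le' hk
  obtain ⟨m, rfl⟩ := Nat.exists_eq_add_of_le' (hk.trans hkn)
  simp only [Nat.add_sub_cancel]
  set N : ℝ := ((m + 1 : ℕ) : ℝ) with hN
  have hN0 : N ≠ 0 := by rw [hN]; positivity
  have h1 : ∏ i ∈ Finset.range (j + 1), (1 - (i : ℝ) / N) =
      ((m + 1).descFactorial (j + 1) : ℝ) / N ^ (j + 1) := by
    have hconst : N ^ (j + 1) = ∏ _i ∈ Finset.range (j + 1), N := by simp
    rw [Nat.descFactorial_eq_prod_range, Nat.cast_prod, hconst, ← Finset.prod_div_distrib]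
    refine Finset.prod_congr rfl fun i hi => ?_
    have : i ≤ m + 1 := by have := Finset.mem_range.1 hi; omega
    rw [Nat.cast_sub this, ← hN, sub_div, div_self hN0]
  have h2 : ((m + 1).descFactorial (j + 1) : ℝ) = N * ((j.factorial : ℝ) * (m.choose j : ℝ)) := by
    rw [Nat.succ_descFactorial_succ, Nat.descFactorial_eq_factorial_mul_choose, hN]
    push_cast; ring
  rw [h1, h2, Nat.factorial_succ]
  push_cast
  have hj : (j.factorial : ℝ) ≠ 0 := by positivity
  have hj1 : (j : ℝ) + 1 ≠ 0 := by positivity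
  rw [div_pow, pow_succ N]
  field_simp

/-- The tree term for `P(|C(v)| = k)`: choices of the `k - 1` other vertices, times the number
`k^(k-2)` of trees on them, times the probability that the `k - 1` tree edges are present and the
edges out of the component are not. The exponent of `1 - p` counts all `k.choose 2` pairs inside
the component, including the tree edges; this changes the term by a bounded factor only. -/
noncomputable def treeTerm (n k : ℕ) (p : ℝ) : ℝ :=
  ((n - 1).choose (k - 1) : ℝ) * p ^ (k - 1) * ((k : ℝ) ^ (k - 1) / k) *
    (1 - p) ^ (k * (n - k) + k.choose 2)

/-- The errors in the expansions of the logarithms are bounded because `k^4/n^3`, `k |x|^3` and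
`k/n` are; the main terms add up to `-F`. -/
lemma abs_log_treeTerm_le {A : ℝ} (hA : 0 ≤ A) {n k : ℕ} (hn : 2 ≤ n) (hk : 1 ≤ k) (hkn : k ≤ n)
    (hkA : (k : ℝ) ^ 3 ≤ A * (n : ℝ) ^ 2) {x : ℝ} (hx : |x| ≤ 17 / 20)
    (hkx : (k : ℝ) * |x| ^ 3 ≤ A) :
    0 < treeTerm n k ((1 + x) / n) ∧
    |Real.log (treeTerm n k ((1 + x) / n)) -
      (-(3 / 2) * Real.log k - ((k : ℝ) ^ 3 / (6 * (n : ℝ) ^ 2) - x * k ^ 2 / (2 * n) +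
        x ^ 2 * k / 2))| ≤ (2 + 8 * A) * A + 7 * A + 62 := by
  rw [treeTerm]
  have hn2 : (2 : ℝ) ≤ n := by exact_mod_cast hn
  have hn0 : (0 : ℝ) < n := by linarith
  have hk1 : (1 : ℝ) ≤ k := by exact_mod_cast hk
  have hkn' : (k : ℝ) ≤ n := by exact_mod_cast hkn
  obtain ⟨hx1, hx2⟩ := abs_le.1 hx
  have hkn1 : (k : ℝ) / n ≤ 1 := by rw [div_le_one hn0]; exact hkn'
  have hkn0 : 0 ≤ (k : ℝ) / n := by positivity
  set p := (1 + x) / n with hp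
  have hp0 : 0 < p := div_pos (by linarith) hn0
  have hpn : p * n = 1 + x := by rw [hp]; field_simp
  have hp1 : p ≤ 37 / 40 := by
    rw [hp, div_le_iff₀ hn0]; linarith
  have hr : 0 < 1 - p := by linarith
  have hprod : ∀ i ∈ Finset.range k, 1 - (i : ℝ) / n ≠ 0 := by
    intro i hi
    have : (i : ℝ) + 1 ≤ k := by exact_mod_cast Finset.mem_range.1 hi
    have : (i : ℝ) / n < 1 := by rw [div_lt_one hn0]; linarith
    linarith
  have hx0 : 0 < 1 + x := by linarith
  have hchoose : 0 < ((n - 1).choose (k - 1) : ℝ) := by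
    exact_mod_cast Nat.choose_pos (by omega)
  refine ⟨by positivity, ?_⟩
  have hk0 : (k : ℝ) ≠ 0 := by linarith
  have hprod0 : ∏ i ∈ Finset.range k, (1 - (i : ℝ) / n) ≠ 0 := Finset.prod_ne_zero_iff.2 hprod
  rw [choose_mul_pow_eq n k hk hkn x, Real.log_mul (by positivity) (by positivity),
    Real.log_mul (by positivity) (by positivity), Real.log_mul (by positivity) (by positivity),
    Real.log_prod hprod, Real.log_pow, Real.log_pow]
  have h1 := abs_sum_log_one_sub_le hA hk hkn hkA
  have h2 := abs_log_tree_sub_le k hk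
  have h3 : |((k - 1 : ℕ) : ℝ) * Real.log (1 + x) - k * (x - x ^ 2 / 2)| ≤ 7 * A + 2 := by
    have h := abs_log_one_sub_add_add_le (t := -x) (B := 7) (by rw [abs_neg]; linarith) (by
      rw [abs_neg, inv_le_comm₀ (by linarith) (by norm_num)]; linarith)
    rw [abs_neg, sub_neg_eq_add, neg_sq] at h
    rw [Nat.cast_sub hk, Nat.cast_one]
    have e : ((k : ℝ) - 1) * Real.log (1 + x) - k * (x - x ^ 2 / 2) =
        (k - 1) * (Real.log (1 + x) + -x + x ^ 2 / 2) - (x - x ^ 2 / 2) := by ring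
    have e1 : |((k : ℝ) - 1) * (Real.log (1 + x) + -x + x ^ 2 / 2)| ≤ 7 * A := by
      rw [abs_mul, abs_of_nonneg (by linarith : (0 : ℝ) ≤ k - 1)]
      calc _ ≤ (k : ℝ) * (7 * |x| ^ 3) :=
            mul_le_mul (by linarith) h (abs_nonneg _) (by linarith)
        _ ≤ _ := by linarith
    have e2 : |x - x ^ 2 / 2| ≤ 2 := by rw [abs_le]; constructor <;> nlinarith
    rw [e]
    exact (abs_sub _ _).trans (by linarith)
  have hE : ((k * (n - k) + k.choose 2 : ℕ) : ℝ) = k * n - k ^ 2 / 2 - k / 2 := by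
    push_cast
    rw [Nat.cast_sub hkn, Nat.cast_choose_two]
    ring
  have h4 : |((k * (n - k) + k.choose 2 : ℕ) : ℝ) * Real.log (1 - p) +
      (1 + x) * (k - k ^ 2 / (2 * n))| ≤ 57 := by
    have h := abs_log_one_sub_add_le (B := 14) hp0.le (by linarith) (by
      rw [inv_le_comm₀ hr (by norm_num)]; linarith)
    set E : ℝ := ((k * (n - k) + k.choose 2 : ℕ) : ℝ) with hEdef
    have hE0 : 0 ≤ E := Nat.cast_nonneg _
    have hEkn : E ≤ k * n := by rw [hE]; nlinarith
    have e : E * Real.log (1 - p) + (1 + x) * (k - k ^ 2 / (2 * n)) =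
        E * (Real.log (1 - p) + p) + (1 + x) * (k / n) / 2 := by
      rw [hE, hp]; field_simp; ring
    have e1 : |E * (Real.log (1 - p) + p)| ≤ 56 := by
      rw [abs_mul, abs_of_nonneg hE0]
      calc _ ≤ (k * n) * (14 * p ^ 2) := mul_le_mul hEkn h (abs_nonneg _) (by positivity)
        _ = 14 * ((k : ℝ) / n) * (p * n) ^ 2 := by field_simp
        _ ≤ 14 * 1 * 2 ^ 2 := by
            rw [hpn]; gcongr; linarith
        _ = 56 := by norm_num
    have e2 : |(1 + x) * ((k : ℝ) / n) / 2| ≤ 1 := by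
      rw [abs_of_nonneg (by positivity)]
      have : (1 + x) * ((k : ℝ) / n) ≤ 2 * 1 := mul_le_mul (by linarith) hkn1 hkn0 (by norm_num)
      linarith
    rw [e]
    exact (abs_add_le _ _).trans (by linarith)
  have hxk : (1 + x) * ((k : ℝ) - k ^ 2 / (2 * n)) =
      k + x * k - k ^ 2 / (2 * n) - x * k ^ 2 / (2 * n) := by ring
  rw [hxk] at h4
  rw [abs_le] at h1 h2 h3 h4 ⊢
  constructor <;> linarith [h1.1, h1.2, h2.1, h2.2, h3.1, h3.2, h4.1, h4.2]

/-- The scaling in terms of `t = n^(1/12)`. -/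
lemma window_param {n : ℕ} {lam : ℝ} (hn0 : (0 : ℝ) < n) :
    0 < (n : ℝ) ^ (1 / 12 : ℝ) ∧ ((n : ℝ) ^ (1 / 12 : ℝ)) ^ 12 = n ∧
      (n : ℝ) ^ (2 / 3 : ℝ) = ((n : ℝ) ^ (1 / 12 : ℝ)) ^ 8 ∧
      ((1 : ℝ) ≤ n → 1 ≤ (n : ℝ) ^ (1 / 12 : ℝ)) ∧
      edgeProb n lam = (1 + lam / ((n : ℝ) ^ (1 / 12 : ℝ)) ^ 4) / n := by
  set t := (n : ℝ) ^ (1 / 12 : ℝ) with ht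
  have ht0 : 0 < t := Real.rpow_pos_of_pos hn0 _
  have htn : t ^ 12 = n := by
    rw [ht, ← Real.rpow_natCast, ← Real.rpow_mul hn0.le]; norm_num
  have ht16 : (n : ℝ) ^ (-(4 / 3) : ℝ) = (t ^ 16)⁻¹ := by
    rw [ht, ← Real.rpow_natCast, ← Real.rpow_mul hn0.le, ← Real.rpow_neg hn0.le]; norm_num
  refine ⟨ht0, htn, ?_, fun h => Real.one_le_rpow h (by norm_num), ?_⟩
  · rw [ht, ← Real.rpow_natCast, ← Real.rpow_mul hn0.le]; norm_num
  · rw [edgeProb, ht16, ← htn]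
    field_simp

lemma abs_div_pow_four_le {n : ℕ} (hn : 2 ≤ n) {t lam : ℝ} (ht : 0 < t) (htn : t ^ 12 = n)
    (hlam : |lam| ≤ t) : |lam / t ^ 4| ≤ 17 / 20 ∧ |lam / t ^ 4| ≤ 1 / t ^ 3 := by
  have h2 : (2 : ℝ) ≤ t ^ 12 := by rw [htn]; exact_mod_cast hn
  have hx : |lam / t ^ 4| ≤ 1 / t ^ 3 := by
    rw [abs_div, abs_of_pos (by positivity : 0 < t ^ 4), div_le_div_iff₀ (by positivity)
      (by positivity)]
    calc _ ≤ t * t ^ 3 := by gcongr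
      _ = _ := by ring
  refine ⟨hx.trans ?_, hx⟩
  rw [div_le_iff₀ (by positivity)]
  by_contra! hlt
  have h3 : t ^ 3 ≤ 20 / 17 := by linarith
  have h4 : (t ^ 3) ^ 4 ≤ (20 / 17) ^ 4 := pow_le_pow_left₀ (by positivity) h3 4
  norm_num at h4
  nlinarith [h4, h2, show (t ^ 3) ^ 4 = t ^ 12 by ring]

lemma erdosRenyiLaw_one (lam : ℝ) (hp : edgeProb 1 lam ∈ Set.Icc (0 : ℝ) 1) (v : Fin 1) :
    (erdosRenyiLaw 1 lam hp).real {G | componentSize G v = 1} = 1 := by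
  have : {G : SimpleGraph (Fin 1) | componentSize G v = 1} = Set.univ := by
    ext G
    simp only [Set.mem_ofPred_eq, Set.mem_univ, iff_true, componentSize]
    have : (G.connectedComponentMk v).supp = {v} := by
      ext w
      rw [Subsingleton.elim w v]
      simp
    rw [this, Set.ncard_singleton]
  rw [this, erdosRenyiLaw]
  exact probReal_univ

/-- `connProb_le` when `p ≤ 2/n` and `k` is of order at most `n^(2/3)`. -/
lemma connProb_le_of_le_div {A : ℝ} (hA : 0 ≤ A) : ∃ C : ℝ, 0 < C ∧
    ∀ (p : ℝ) (n k : ℕ), 0 ≤ p → p ≤ 37 / 40 → p * n ≤ 2 → 1 ≤ k →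
      (k : ℝ) ^ 3 ≤ A * (n : ℝ) ^ 2 →
      connProb p k ≤ C * (p ^ (k - 1) * (1 - p) ^ (k.choose 2) * ((k : ℝ) ^ (k - 1) / k)) := by
  obtain ⟨C, hC0, hC⟩ := connProb_le (28 * (A + 1)) (by positivity)
  refine ⟨C, hC0, fun p n k hp0 hp1 hpn hk hkA => hC p k hp0 (by linarith) hk ?_⟩
  have hr : 0 < 1 - p := by linarith
  have hk1 : (1 : ℝ) ≤ k := by exact_mod_cast hk
  have h1 : -Real.log (1 - p) ≤ 14 * p := by
    have e1 := Real.one_sub_inv_le_log_of_pos hr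
    have e2 : (1 - p)⁻¹ - 1 = p * (1 - p)⁻¹ := by field_simp; ring
    have e3 : (1 - p)⁻¹ ≤ 14 := by
      rw [inv_le_comm₀ hr (by norm_num)]; linarith
    have e4 := mul_le_mul_of_nonneg_left e3 hp0
    linarith
  have h2 : (k : ℝ) * √k ≤ (A + 1) * n := by
    have e : ((k : ℝ) * √k) ^ 2 = (k : ℝ) ^ 3 := by
      rw [mul_pow, Real.sq_sqrt (by linarith)]; ring
    refine (pow_le_pow_iff_left₀ (by positivity) (by positivity) two_ne_zero).1 ?_
    rw [e, mul_pow]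
    refine hkA.trans (mul_le_mul_of_nonneg_right ?_ (sq_nonneg _))
    nlinarith
  calc _ ≤ 14 * p * ((A + 1) * n) := mul_le_mul h1 h2 (by positivity) (by positivity)
    _ = 14 * (A + 1) * (p * n) := by ring
    _ ≤ 14 * (A + 1) * 2 := by gcongr
    _ = _ := by ring

lemma edgeProb_window {n : ℕ} (hn : 2 ≤ n) {lam : ℝ} (hlam : |lam| ≤ (n : ℝ) ^ (1 / 12 : ℝ)) :
    0 < edgeProb n lam ∧ edgeProb n lam ≤ 37 / 40 ∧ edgeProb n lam * n ≤ 2 := by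
  have hn2 : (2 : ℝ) ≤ n := by exact_mod_cast hn
  have hn0 : (0 : ℝ) < n := by linarith
  obtain ⟨ht0, htn, -, -, hpx⟩ := window_param (lam := lam) hn0
  obtain ⟨hx, -⟩ := abs_div_pow_four_le hn ht0 htn hlam
  obtain ⟨hx1, hx2⟩ := abs_le.1 hx
  rw [hpx]
  refine ⟨div_pos (by linarith) hn0, ?_, ?_⟩
  · rw [div_le_iff₀ hn0]; linarith
  · rw [div_mul_cancel₀ _ hn0.ne']; linarith

/-- Up to constants, the tree term is `k^(-3/2) e^(-F_λ(k / n^(2/3)))` in the critical window. -/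
lemma treeTerm_bounds {M : ℝ} (hM : 0 < M) : ∃ L : ℝ, 2 ≤ L ∧ ∀ (n k : ℕ) (lam : ℝ), 2 ≤ n →
    |lam| ≤ (n : ℝ) ^ (1 / 12 : ℝ) → 1 ≤ k → k ≤ n → (k : ℝ) ≤ M * (n : ℝ) ^ (2 / 3 : ℝ) →
    Real.exp (-L) * ((k : ℝ) ^ (-(3 / 2) : ℝ) *
        Real.exp (-critF lam ((k : ℝ) / (n : ℝ) ^ (2 / 3 : ℝ)))) ≤
      treeTerm n k (edgeProb n lam) ∧
    treeTerm n k (edgeProb n lam) ≤ Real.exp L * ((k : ℝ) ^ (-(3 / 2) : ℝ) *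
        Real.exp (-critF lam ((k : ℝ) / (n : ℝ) ^ (2 / 3 : ℝ)))) := by
  set A := M + M ^ 3 with hA
  have hA0 : 0 < A := by positivity
  refine ⟨(2 + 8 * A) * A + 7 * A + 62, ?_, ?_⟩
  · linarith [mul_pos (by positivity : 0 < 2 + 8 * A) hA0]
  intro n k lam hn hlam hk hkn hkM
  have hn2 : (2 : ℝ) ≤ n := by exact_mod_cast hn
  have hn0 : (0 : ℝ) < n := by linarith
  have hk0 : (0 : ℝ) < k := by exact_mod_cast hk
  -- all powers of `n` are written as powers of `t = n^(1/12)`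
  obtain ⟨ht0, htn, ht8, ht1, hpx⟩ := window_param (lam := lam) hn0
  replace ht1 := ht1 (by linarith)
  set t := (n : ℝ) ^ (1 / 12 : ℝ) with ht
  obtain ⟨hx, hx3⟩ := abs_div_pow_four_le hn ht0 htn hlam
  have hF : critF lam ((k : ℝ) / t ^ 8) = (k : ℝ) ^ 3 / (6 * (n : ℝ) ^ 2) -
      lam / t ^ 4 * k ^ 2 / (2 * n) + (lam / t ^ 4) ^ 2 * k / 2 := by
    rw [critF, ← htn]
    field_simp
  rw [hpx, ht8, hF]
  rw [ht8] at hkM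
  generalize lam / t ^ 4 = x at hx hx3 ⊢
  have hkA : (k : ℝ) ^ 3 ≤ A * (n : ℝ) ^ 2 := by
    calc (k : ℝ) ^ 3 ≤ (M * t ^ 8) ^ 3 := by gcongr
      _ = M ^ 3 * (n : ℝ) ^ 2 := by rw [← htn]; ring
      _ ≤ _ := by gcongr; linarith
  have hkx : (k : ℝ) * |x| ^ 3 ≤ A := by
    calc _ ≤ (M * t ^ 8) * (1 / t ^ 3) ^ 3 := by gcongr
      _ = M * (1 / t) := by field_simp
      _ ≤ M * 1 := by
          gcongr
          rw [div_le_one ht0]; exact ht1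
      _ ≤ A := by rw [hA, mul_one]; linarith [pow_pos hM 3]
  obtain ⟨hpos, hlog⟩ := abs_log_treeTerm_le hA0.le hn hk hkn hkA hx hkx
  obtain ⟨hl1, hl2⟩ := abs_le.1 hlog
  rw [Real.rpow_def_of_pos hk0, ← Real.exp_add, ← Real.exp_add, ← Real.exp_add,
    ← Real.le_log_iff_exp_le hpos, ← Real.log_le_iff_le_exp hpos]
  constructor <;> linarith

theorem proposition2p7 (M : ℝ) (hM : 0 < M) :
    ∃ c₁ c₂ : ℝ, 0 < c₁ ∧ c₁ ≤ c₂ ∧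
      ∀ (n : ℕ) (lam : ℝ) (hp : edgeProb n lam ∈ Set.Icc (0 : ℝ) 1),
        |lam| ≤ (n : ℝ) ^ (1 / 12 : ℝ) →
        ∀ (v : Fin n) (k : ℕ), 1 ≤ k → k ≤ n → (k : ℝ) ≤ M * (n : ℝ) ^ (2 / 3 : ℝ) →
          c₁ * (k : ℝ) ^ (-(3 / 2) : ℝ) * Real.exp (-critF lam ((k : ℝ) / (n : ℝ) ^ (2 / 3 : ℝ)))
              ≤ (erdosRenyiLaw n lam hp).real {G | componentSize G v = k} ∧
          (erdosRenyiLaw n lam hp).real {G | componentSize G v = k}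
              ≤ c₂ * (k : ℝ) ^ (-(3 / 2) : ℝ)
                * Real.exp (-critF lam ((k : ℝ) / (n : ℝ) ^ (2 / 3 : ℝ))) := by
  obtain ⟨L, hL2, hL⟩ := treeTerm_bounds hM
  obtain ⟨C, hC0, hC⟩ := connProb_le_of_le_div (A := M ^ 3) (by positivity)
  refine ⟨Real.exp (-L), (C + 1) * Real.exp L, Real.exp_pos _, ?_, ?_⟩
  · calc Real.exp (-L) ≤ Real.exp L := Real.exp_le_exp.2 (by linarith)
      _ ≤ _ := le_mul_of_one_le_left (Real.exp_pos _).le (by linarith)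
  intro n lam hp hlam v k hk hkn hkM
  rcases Nat.lt_or_ge n 2 with hn | hn
  · -- one vertex: the probability is `1`, and `F` is bounded
    obtain rfl : n = 1 := by omega
    obtain rfl : k = 1 := by omega
    rw [erdosRenyiLaw_one]
    norm_num at hlam ⊢
    obtain ⟨hl1, hl2⟩ := abs_le.1 hlam
    have hF : |critF lam 1| ≤ 2 := by
      rw [critF, abs_le]; constructor <;> nlinarith
    obtain ⟨hF1, hF2⟩ := abs_le.1 hF
    constructor
    · rw [← Real.exp_add]
      exact Real.exp_le_one_iff.2 (by linarith)
    · rw [mul_assoc, ← Real.exp_add]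
      exact one_le_mul_of_one_le_of_one_le (by linarith) (Real.one_le_exp (by linarith))
  obtain ⟨hlow, hup⟩ := hL n k lam hn hlam hk hkn hkM
  obtain ⟨hp0, hp1, hpn⟩ := edgeProb_window hn hlam
  have hkA : (k : ℝ) ^ 3 ≤ M ^ 3 * (n : ℝ) ^ 2 := by
    have hpow : ((n : ℝ) ^ (2 / 3 : ℝ)) ^ 3 = (n : ℝ) ^ 2 := by
      rw [← Real.rpow_natCast, ← Real.rpow_mul (Nat.cast_nonneg n)]
      norm_num
    calc (k : ℝ) ^ 3 ≤ (M * (n : ℝ) ^ (2 / 3 : ℝ)) ^ 3 := by gcongr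
      _ = _ := by rw [mul_pow, hpow]
  have hcl := le_connProb (edgeProb n lam) hp0.le (by linarith) k hk
  have hcu := hC (edgeProb n lam) n k hp0.le hp1 hpn hk hkA
  rw [erdosRenyiLaw_componentSize lam hp v k hk, mul_assoc, mul_assoc ((C + 1) * Real.exp L)]
  generalize (k : ℝ) ^ (-(3 / 2) : ℝ) *
    Real.exp (-critF lam ((k : ℝ) / (n : ℝ) ^ (2 / 3 : ℝ))) = E at hlow hup ⊢
  generalize edgeProb n lam = p at *
  have hr : 0 < 1 - p := by linarith
  have hfac : 0 ≤ ((n - 1).choose (k - 1) : ℝ) * (1 - p) ^ (k * (n - k)) := by positivity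
  have hB : treeTerm n k p = ((n - 1).choose (k - 1) : ℝ) * (1 - p) ^ (k * (n - k)) *
      (p ^ (k - 1) * (1 - p) ^ (k.choose 2) * ((k : ℝ) ^ (k - 1) / k)) := by
    rw [treeTerm, pow_add]; ring
  have hB0 : 0 ≤ treeTerm n k p := by rw [treeTerm]; positivity
  rw [mul_right_comm _ (connProb p k)]
  constructor
  · refine hlow.trans ?_
    rw [hB]
    exact mul_le_mul_of_nonneg_left hcl hfac
  · calc _ ≤ C * treeTerm n k p := by
          rw [hB, mul_left_comm]
          exact mul_le_mul_of_nonneg_left hcu hfac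
      _ ≤ (C + 1) * treeTerm n k p := mul_le_mul_of_nonneg_right (by linarith) hB0
      _ ≤ (C + 1) * (Real.exp L * E) := mul_le_mul_of_nonneg_left hup (by linarith)
      _ = _ := by ring
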